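/- **Setting.** A binary Tanner code is given by a bipartite graph $G$ with variable nodes $v_1,\dots,v_N$ and local-code nodes $C_1,\dots,C_J$, where the edges at $C_j$ are labelled $1,\dots,n_j$, and by linear local codes $\overline{\mathcal C}^j\subseteq\{0,1\}^{n_j}$. Let $\mathcal C^j$ be the set of $x\in\{0,1\}^N$ whose projection to the (ordered) neighbours of $C_j$ is in $\overline{\mathcal C}^j$. The code is $\mathcal C=\bigcap_j\mathcal C^j$, its generalized fundamental polytope is $\mathcal P=\bigcap_j\mathrm{conv}(\mathcal C^j)\subset\mathbb R^N$, and its minimum local distance $d^*$ is the least minimum distance of a local code. It is $(d_L,d_R)$-regular if all variable nodes have degree $d_L$ and all local-code nodes have degree $d_R$. An MBIOS channel is given by conditional densities on $\mathbb R$ with $f(y\mid 0)=f(-y\mid 1)$ (with respect to a reference measure invariant under $y\mapsto-y$) and acts independently on the symbols. The log-likelihood ratios (LLRs) of a received word $y\in\mathbb R^N$ are $\lambda_i=\ln\frac{f(y_i\mid 0)}{f(y_i\mid 1)}$. LP decoding of $y$ succeeds, when $c\in\mathcal C$ was sent, if $c$ is the unique minimizer of $\langle\lambda,x\rangle$ over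 $x\in\mathcal P$. (If some LLRs are infinite, as on an erasure channel, this means $\sum_i\lambda_i(x_i-c_i)>0$ for all $x\in\mathcal P\setminus\{c\}$, with $\pm\infty\cdot0=0$; an undefined sum $\infty-\infty$ counts as a failure.) **Theorem.** Consider an MBIOS channel and integers $d_L,d_R$ and $d\ge2$ with $(d_L-1)(d-1)\ge2$. Let $\gamma$ be distributed as the LLR of one received symbol given that $0$ was sent, let $\gamma^{(1)},\dots,\gamma^{(d_R-1)}$ be independent copies of $\gamma$, and let $X_0=\sum_{i=1}^{d-1}\min^{[i]}\{\gamma^{(1)},\dots,\gamma^{(d_R-1)}\}$ be the sum of the $d-1$ smallest of them. Suppose that $$\min_{t\ge0}\left\{\mathbb E e^{-tX_0}\cdot\left(\binom{d_R-1}{d-1}\big(\mathbb E e^{-t\gamma}\big)^{d-1}\right)^{\frac1{(d_L-1)(d-1)-1}}\right\}<1 .$$ Then for every $\kappa>0$ there are a constant $0<\delta<1$ and an $N_0$ such that for every $N\ge N_0$, every $(d_L,d_R)$-regular Tanner code of length $N$ with minimum local distance $d^*\ge d$ whose graph has girth at least $\kappa\log N$, and every transmitted codeword $c$, LP decoding succeeds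 with probability at least $1-\exp(-N^\delta)$. -/

import Mathlib

open MeasureTheory
open scoped ENNReal NNReal

noncomputable section

/-- An edge-labelled Tanner graph on `N` variable nodes and `J` local-code nodes, together with a
binary linear local code for every local-code node. The node `j` has degree `len j`, its incident
edges are labelled by `Fin (len j)`, and `nbr j k` is the variable node at the end of the edge
with label `k`; distinct labels lead to distinct variable nodes. -/
structure TannerCode (N J : ℕ) where
  len : Fin J → ℕ
  nbr : (j : Fin J) → Fin (len j) ↪ Fin N
  localCode : (j : Fin J) → Submodule (ZMod 2) (Fin (len j) → ZMod 2)

/-- The real `0`-`1` vector of a binary word. -/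
def bitsToReal {N : ℕ} (x : Fin N → ZMod 2) : Fin N → ℝ := fun i => ((x i).val : ℝ)

namespace TannerCode

variable {N J : ℕ}

/-- The underlying bipartite graph. -/
def graph (T : TannerCode N J) : SimpleGraph (Fin N ⊕ Fin J) :=
  SimpleGraph.fromRel fun a b =>
    ∃ (i : Fin N) (j : Fin J), a = Sum.inl i ∧ b = Sum.inr j ∧ i ∈ Set.range (T.nbr j)

/-- Every variable node has degree `dL` and every local-code node has degree `dR`. -/
def IsRegular (T : TannerCode N J) (dL dR : ℕ) : Prop :=
  (∀ i : Fin N, (T.graph.neighborSet (Sum.inl i)).ncard = dL) ∧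
    ∀ j : Fin J, (T.graph.neighborSet (Sum.inr j)).ncard = dR

/-- The words of length `N` whose projection to the neighbours of `j` lies in the `j`-th
local code. -/
def extendedCode (T : TannerCode N J) (j : Fin J) : Set (Fin N → ZMod 2) :=
  {x | (fun k => x (T.nbr j k)) ∈ T.localCode j}

/-- The Tanner code. -/
def code (T : TannerCode N J) : Set (Fin N → ZMod 2) :=
  ⋂ j, T.extendedCode j

/-- The minimum distance of the `j`-th local code (`⊤` if that code has only one codeword). -/
def localDist (T : TannerCode N J) (j : Fin J) : ℕ∞ :=
  ⨅ (u ∈ T.localCode j) (v ∈ T.localCode j) (_ : u ≠ v), (hammingDist u v : ℕ∞)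

/-- The minimum local distance `d^*`. -/
def minLocalDist (T : TannerCode N J) : ℕ∞ :=
  ⨅ j, T.localDist j

/-- The generalized fundamental polytope. -/
def polytope (T : TannerCode N J) : Set (Fin N → ℝ) :=
  ⋂ j, convexHull ℝ (bitsToReal '' T.extendedCode j)

/-- `c` is the unique minimizer of `x ↦ ⟨l, x⟩` over the generalized fundamental polytope.
The log-likelihood ratios `l i` may be infinite, as on an erasure channel, so the condition is put
on the difference `∑ i, l i * (x i - c i)` of the two objective values, with `⊤ * 0 = ⊥ * 0 = 0`
and `⊤ + ⊥ = ⊥` (so that an undefined difference counts as a failure). For finite `l` this is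
literally unique optimality: see `isUniqueLPOptimum_coe_iff`. -/
def IsUniqueLPOptimum (T : TannerCode N J) (l : Fin N → EReal) (c : Fin N → ZMod 2) : Prop :=
  bitsToReal c ∈ T.polytope ∧
    ∀ x ∈ T.polytope, x ≠ bitsToReal c →
      0 < ∑ i, l i * ((x i - bitsToReal c i : ℝ) : EReal)

theorem isUniqueLPOptimum_coe_iff (T : TannerCode N J) (l : Fin N → ℝ) (c : Fin N → ZMod 2) :
    T.IsUniqueLPOptimum (fun i => (l i : EReal)) c ↔
      bitsToReal c ∈ T.polytope ∧ ∀ x ∈ T.polytope, x ≠ bitsToReal c →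
        ∑ i, l i * bitsToReal c i < ∑ i, l i * x i := by
  have key : ∀ x : Fin N → ℝ,
      (0 < ∑ i, (l i : EReal) * ((x i - bitsToReal c i : ℝ) : EReal)) ↔
        ∑ i, l i * bitsToReal c i < ∑ i, l i * x i := by
    intro x
    have h : ∑ i, (l i : EReal) * ((x i - bitsToReal c i : ℝ) : EReal) =
        ((∑ i, l i * (x i - bitsToReal c i) : ℝ) : EReal) := by
      induction (Finset.univ : Finset (Fin N)) using Finset.cons_induction with
      | empty => simp
      | cons a s ha ih => rw [Finset.sum_cons, Finset.sum_cons, ih, EReal.coe_add, EReal.coe_mul]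
    rw [h, EReal.coe_pos]
    simp only [mul_sub, Finset.sum_sub_distrib, sub_pos]
  simp only [IsUniqueLPOptimum, key]

end TannerCode

/-- A memoryless binary-input output-symmetric channel: conditional output densities
`density 0`, `density 1` with respect to a reference measure on the real line that is invariant
under `y ↦ -y` (Lebesgue measure for a continuous channel, a counting measure for a discrete
one), subject to `density 0 y = density 1 (-y)`. -/
structure MBIOSChannel where
  ref : Measure ℝ
  ref_neg : ref.map (fun y => -y) = ref
  density : ZMod 2 → ℝ → ℝ≥0
  measurable_density : ∀ a, Measurable (density a)
  lintegral_density : ∀ a, ∫⁻ y, (density a y : ℝ≥0∞) ∂ref = 1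
  symm : ∀ y, density 0 y = density 1 (-y)

namespace MBIOSChannel

/-- The law of the channel output when the bit `a` is sent. -/
def law (W : MBIOSChannel) (a : ZMod 2) : Measure ℝ :=
  W.ref.withDensity fun y => (W.density a y : ℝ≥0∞)

instance instIsProbabilityMeasureLaw (W : MBIOSChannel) (a : ZMod 2) : IsProbabilityMeasure (W.law a) :=
  ⟨by rw [law, withDensity_apply _ MeasurableSet.univ, Measure.restrict_univ,
    W.lintegral_density a]⟩

/-- The law of the received word when the word `c` is sent: the channel is memoryless. -/
def wordLaw (W : MBIOSChannel) {N : ℕ} (c : Fin N → ZMod 2) : Measure (Fin N → ℝ) :=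
  Measure.pi fun i => W.law (c i)

/-- The log-likelihood ratio `ln (f(y|0) / f(y|1))`; it is infinite where exactly one of the two
densities vanishes. -/
def llr (W : MBIOSChannel) (y : ℝ) : EReal :=
  ENNReal.log ((W.density 0 y : ℝ≥0∞) / (W.density 1 y : ℝ≥0∞))

end MBIOSChannel

/-- The sum of the `k` smallest members of the family `v` (with multiplicity). -/
def sumSmallest {n : ℕ} (k : ℕ) (v : Fin n → EReal) : EReal :=
  ∑ i ∈ (Finset.univ : Finset (Fin n)).filter (fun i : Fin n => i.val < k), v (Tuple.sort v i)

namespace MBIOSChannel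

/-- `E e^{-tγ}`, where `γ` is the log-likelihood ratio of a received symbol given that `0` was
sent. -/
def expGamma (W : MBIOSChannel) (t : ℝ≥0) : ℝ≥0∞ :=
  ∫⁻ y, EReal.exp (-(((t : ℝ) : EReal) * W.llr y)) ∂(W.law 0)

/-- `E e^{-t X₀}`, where `X₀` is the sum of the `k` smallest of `n` independent copies of the
log-likelihood ratio `γ` given that `0` was sent. -/
def expXZero (W : MBIOSChannel) (n k : ℕ) (t : ℝ≥0) : ℝ≥0∞ :=
  ∫⁻ y : Fin n → ℝ, EReal.exp (-(((t : ℝ) : EReal) * sumSmallest k fun i => W.llr (y i)))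
    ∂(Measure.pi fun _ => W.law 0)

end MBIOSChannel

end

/-! By the symmetry of the channel and of the polytope, the zero word may be assumed sent. For t > 0
put z_i = e^{-tλ_i} and iterate the min-sum messages `msg` with k = d - 1.

Deterministic half (`sum_neg_log_mul_pos`): if all messages are below 1 after some number h of
rounds, zero is the unique LP optimum. Each local convex hull supplies symmetric pair weights with
row sums (d-1)x_i and entries at most x_i (`exists_pairing`). Hence, at a local-code node, the
x-weighted cost of the cheapest choices of d-1 neighbours is at most d-1 times the x-weighted
incoming cost. With Q = ∑ -log(z_i) x_i, the potential Φ_h = ∑ x_i (-log msg_h(i,j)) over edges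
satisfies Φ_0 = dL·Q and Φ_{h+1} ≤ dL·Q + (dL-1)(d-1)Φ_h. So Φ_h ≤ A·Q with A ≥ 0, and Φ_h > 0
forces Q > 0.

Probabilistic half: below the girth, the messages entering a node are functions of disjoint sets of
symbols. Independence, and a sum in place of each maximum, give the recursion u_{h+1} = C u_h^D with
D = (dL-1)(d-1) and C = binom(dR-1, d-1)(E e^{-tγ})^{d-1}; only at the leaves is the maximum kept,
so u_0 ≤ E e^{-tX₀}. The hypothesis says that some t makes u_0 C^{1/(D-1)} < 1, whence doubly
exponential decay (`exists_mul_checkBound_le`). At height proportional to log N this is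
exp(-const·N^a), and Markov's inequality with a union bound over the N·dL edges concludes. -/

noncomputable section

/-! ### Pair weights and the deterministic optimality certificate -/

/-- A linear functional on a dilated hypersimplex is bounded below by its value at a vertex. -/
theorem exists_powersetCard_mul_sum_le {ι : Type*} [DecidableEq ι] (s : Finset ι) (k : ℕ)
    (M f : ι → ℝ) (x : ℝ) (hx : 0 < x) (hM0 : ∀ i ∈ s, 0 ≤ M i) (hMx : ∀ i ∈ s, M i ≤ x)
    (hsum : ∑ i ∈ s, M i = k * x) :
    ∃ S ∈ s.powersetCard k, x * ∑ i ∈ S, f i ≤ ∑ i ∈ s, M i * f i := by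
  have hk : k ≤ s.card := by
    have h : (k : ℝ) * x ≤ s.card * x := by
      rw [← hsum, ← nsmul_eq_mul]
      exact Finset.sum_le_card_nsmul _ _ _ hMx
    exact_mod_cast le_of_mul_le_mul_right h hx
  obtain ⟨S, hS, hmin⟩ := Finset.exists_min_image (s.powersetCard k) (fun S => ∑ i ∈ S, f i)
    (Finset.powersetCard_nonempty.2 hk)
  obtain ⟨hSs, hSk⟩ := Finset.mem_powersetCard.1 hS
  have hswap : ∀ a ∈ S, ∀ b ∈ s \ S, f a ≤ f b := by
    intro a ha b hb
    obtain ⟨hbs, hbS⟩ := Finset.mem_sdiff.1 hb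
    have hb' : b ∉ S.erase a := fun h => hbS (Finset.mem_of_mem_erase h)
    have h := hmin (insert b (S.erase a)) (Finset.mem_powersetCard.2
      ⟨Finset.insert_subset hbs ((Finset.erase_subset _ _).trans hSs), by
        rw [Finset.card_insert_of_notMem hb', Finset.card_erase_add_one ha, hSk]⟩)
    rw [Finset.sum_insert hb', ← Finset.add_sum_erase S f ha] at h
    linarith
  -- τ separates the values of f on S from those off S. Replacing f by f - τ lowers both sides by k
  -- * x * τ, after which the terms compare one by one.
  obtain ⟨τ, hτ1, hτ2⟩ : ∃ τ : ℝ, (∀ a ∈ S, f a ≤ τ) ∧ ∀ b ∈ s \ S, τ ≤ f b := by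
    rcases S.eq_empty_or_nonempty with rfl | hne
    · rcases (s \ ∅).eq_empty_or_nonempty with h | h
      · exact ⟨0, by simp, by simp [h]⟩
      · obtain ⟨b, hb, hb'⟩ := Finset.exists_min_image _ f h
        exact ⟨f b, by simp, hb'⟩
    · obtain ⟨a, ha, ha'⟩ := Finset.exists_max_image _ f hne
      exact ⟨f a, ha', hswap a ha⟩
  refine ⟨S, hS, ?_⟩
  have e1 : ∑ i ∈ s \ S, M i * (f i - τ) + ∑ i ∈ S, M i * (f i - τ)
      = ∑ i ∈ s, M i * f i - k * x * τ := by
    rw [Finset.sum_sdiff hSs, ← hsum, Finset.sum_mul, ← Finset.sum_sub_distrib]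
    exact Finset.sum_congr rfl fun i _ => by ring
  have e2 : ∑ i ∈ S, x * (f i - τ) = x * ∑ i ∈ S, f i - k * x * τ := by
    rw [← Finset.mul_sum, Finset.sum_sub_distrib, Finset.sum_const, hSk, nsmul_eq_mul]
    ring
  have e3 : 0 ≤ ∑ i ∈ s \ S, M i * (f i - τ) := Finset.sum_nonneg fun i hi =>
    mul_nonneg (hM0 i (Finset.mem_sdiff.1 hi).1) (sub_nonneg.2 (hτ2 i hi))
  have e4 : ∑ i ∈ S, x * (f i - τ) ≤ ∑ i ∈ S, M i * (f i - τ) := Finset.sum_le_sum fun i hi =>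
    mul_le_mul_of_nonpos_right (hMx i (hSs hi)) (sub_nonpos.2 (hτ1 i hi))
  linarith

/-- The largest product of `k` of the numbers `z i`, `i ∈ s`. -/
def maxProd {ι : Type*} (k : ℕ) (s : Finset ι) (z : ι → ℝ≥0) : ℝ≥0 :=
  (s.powersetCard k).sup fun S => ∏ i ∈ S, z i

namespace TannerCode

variable {N J : ℕ}

/-- The variable nodes adjacent to the local-code node `j`. -/
def nb (T : TannerCode N J) (j : Fin J) : Finset (Fin N) := Finset.univ.map (T.nbr j)

/-- The local-code nodes adjacent to the variable node `i`. -/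
def checks (T : TannerCode N J) (i : Fin N) : Finset (Fin J) :=
  Finset.univ.filter fun j => i ∈ T.nb j

theorem mem_checks {T : TannerCode N J} {i : Fin N} {j : Fin J} :
    j ∈ T.checks i ↔ i ∈ T.nb j := by simp [checks]

theorem mem_nb_iff_range {T : TannerCode N J} {i : Fin N} {j : Fin J} :
    i ∈ T.nb j ↔ i ∈ Set.range (T.nbr j) := by simp [nb]

theorem sum_checks_comm (T : TannerCode N J) (F : Fin N → Fin J → ℝ) :
    ∑ i, ∑ j ∈ T.checks i, F i j = ∑ j, ∑ i ∈ T.nb j, F i j :=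
  Finset.sum_comm' fun i j => by simp [mem_checks]

/-- The min-sum message from the variable node `i` to the local-code node `j`, after `h` rounds and
in multiplicative form: the largest product of the `z`-values over the trees of height `2 * h` that
hang from `i` away from `j` and in which every local-code node has `k` children. -/
def msg (T : TannerCode N J) (k : ℕ) (z : Fin N → ℝ≥0) : ℕ → Fin N → Fin J → ℝ≥0
  | 0, i, _ => z i
  | h + 1, i, j => z i * ∏ j' ∈ (T.checks i).erase j,
      maxProd k ((T.nb j').erase i) fun i' => msg T k z h i' j'

/-- Spread the weight evenly over the off-diagonal pairs of the support s of w at j. If s is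
nonempty then |s| ≥ d, so the weight (d-1)/(|s|-1) is at most 1, and each row of s has |s|-1 such
entries. -/
theorem exists_pairing_of_mem_extendedCode (T : TannerCode N J) (j : Fin J) (d : ℕ) (hd : 2 ≤ d)
    (hT : (d : ℕ∞) ≤ T.minLocalDist) (w : Fin N → ZMod 2) (hw : w ∈ T.extendedCode j) :
    ∃ M : Fin N → Fin N → ℝ, (∀ a b, M a b = M b a) ∧ (∀ a, M a a = 0) ∧ (∀ a b, 0 ≤ M a b) ∧
      (∀ a b, M a b ≤ bitsToReal w a) ∧
      ∀ a ∈ T.nb j, ∑ b ∈ T.nb j, M a b = ((d - 1 : ℕ) : ℝ) * bitsToReal w a := by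
  have hbit : ∀ a, bitsToReal w a = if w a = 0 then 0 else 1 := by
    intro a
    unfold bitsToReal
    have hb : ∀ b : ZMod 2, b = 0 ∨ b = 1 := by decide
    rcases hb (w a) with h | h <;> simp [h, ZMod.val_one]
  set s : Finset (Fin N) := (T.nb j).filter fun i => w i ≠ 0 with hs
  have hcard : s.Nonempty → d ≤ s.card := by
    rintro ⟨i, hi⟩
    obtain ⟨hi, hwi⟩ := Finset.mem_filter.1 hi
    obtain ⟨k, hk⟩ := mem_nb_iff_range.1 hi
    have hne : (fun k => w (T.nbr j k)) ≠ 0 := fun h => hwi (by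
      have := congrFun h k
      simpa [hk] using this)
    have h1 : (d : ℕ∞) ≤ (hammingDist (fun k => w (T.nbr j k)) 0 : ℕ) :=
      hT.trans ((iInf_le _ j).trans ((iInf₂_le (fun k => w (T.nbr j k)) hw).trans
        ((iInf₂_le 0 (T.localCode j).zero_mem).trans (iInf_le _ hne))))
    have h2 : s.card = hammingDist (fun k => w (T.nbr j k)) 0 := by
      rw [hammingDist_zero_right, hammingNorm, hs, nb, Finset.filter_map, Finset.card_map]
      rfl
    rw [h2]
    exact_mod_cast h1
  refine ⟨fun a b => if a ∈ s ∧ b ∈ s ∧ a ≠ b then ((d - 1 : ℕ) : ℝ) / ((s.card - 1 : ℕ) : ℝ) else 0,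
    ?_, ?_, ?_, ?_, ?_⟩
  · intro a b
    refine if_congr ?_ rfl rfl
    tauto
  · intro a; simp
  · intro a b
    beta_reduce
    split_ifs
    · positivity
    · rfl
  · intro a b
    beta_reduce
    split_ifs with h
    · have hwa : w a ≠ 0 := (Finset.mem_filter.1 h.1).2
      have hc := hcard ⟨a, h.1⟩
      rw [hbit, if_neg hwa]
      refine div_le_one_of_le₀ ?_ (by positivity)
      exact_mod_cast Nat.sub_le_sub_right hc 1
    · rw [hbit]; split_ifs <;> norm_num
  · intro a ha
    by_cases hwa : w a = 0
    · have : a ∉ s := fun h => (Finset.mem_filter.1 h).2 hwa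
      simp [hbit, hwa, this]
    · have has : a ∈ s := Finset.mem_filter.2 ⟨ha, hwa⟩
      have hc := hcard ⟨a, has⟩
      have hset : (T.nb j).filter (fun b => a ∈ s ∧ b ∈ s ∧ a ≠ b) = s.erase a := by
        ext b
        simp only [Finset.mem_filter, Finset.mem_erase, hs]
        have := (Finset.mem_filter.1 has)
        grind
      rw [← Finset.sum_filter, hset, Finset.sum_const, Finset.card_erase_of_mem has, nsmul_eq_mul,
        hbit, if_neg hwa, mul_one, mul_div_cancel₀]
      have : 0 < s.card - 1 := by omega
      positivity

/-- A point of the convex hull of an extended local code is balanced by a symmetric array of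
pair weights. -/
theorem exists_pairing (T : TannerCode N J) (j : Fin J) (d : ℕ) (hd : 2 ≤ d)
    (hT : (d : ℕ∞) ≤ T.minLocalDist) (x : Fin N → ℝ)
    (hx : x ∈ convexHull ℝ (bitsToReal '' T.extendedCode j)) :
    ∃ M : Fin N → Fin N → ℝ, (∀ a b, M a b = M b a) ∧ (∀ a, M a a = 0) ∧ (∀ a b, 0 ≤ M a b) ∧
      (∀ a b, M a b ≤ x a) ∧
      ∀ a ∈ T.nb j, ∑ b ∈ T.nb j, M a b = ((d - 1 : ℕ) : ℝ) * x a := by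
  revert x
  refine convexHull_min (t := {x | _}) ?_ ?_
  · rintro _ ⟨w, hw, rfl⟩
    exact T.exists_pairing_of_mem_extendedCode j d hd hT w hw
  · rintro x ⟨M, h1, h2, h3, h4, h5⟩ y ⟨M', h1', h2', h3', h4', h5'⟩ p q hp hq -
    refine ⟨fun a b => p * M a b + q * M' a b, fun a b => by simp only [h1 a b, h1' a b], fun a => by simp [h2, h2'],
      fun a b => add_nonneg (mul_nonneg hp (h3 a b)) (mul_nonneg hq (h3' a b)),
      fun a b => add_le_add (mul_le_mul_of_nonneg_left (h4 a b) hp)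
        (mul_le_mul_of_nonneg_left (h4' a b) hq), fun a ha => ?_⟩
    rw [Finset.sum_add_distrib, ← Finset.mul_sum, ← Finset.mul_sum, h5 a ha, h5' a ha]
    simp only [Pi.add_apply, Pi.smul_apply, smul_eq_mul]
    ring

theorem nonneg_of_mem_convexHull (T : TannerCode N J) (j : Fin J) (x : Fin N → ℝ)
    (hx : x ∈ convexHull ℝ (bitsToReal '' T.extendedCode j)) (i : Fin N) : 0 ≤ x i := by
  have : convexHull ℝ (bitsToReal '' T.extendedCode j) ⊆ {x | 0 ≤ x i} := by
    refine convexHull_min ?_ ?_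
    · rintro _ ⟨w, -, rfl⟩
      exact Nat.cast_nonneg (α := ℝ) _
    · intro x hx y hy p q hp hq _
      exact add_nonneg (mul_nonneg hp hx) (mul_nonneg hq hy)
  exact this hx

/-- `hk` matters because `maxProd` over an empty family of subsets is 0; positivity is needed to
take logarithms. -/
theorem msg_pos (T : TannerCode N J) {k : ℕ} {z : Fin N → ℝ≥0} (hz : ∀ i, 0 < z i)
    (hk : ∀ j, ∀ i ∈ T.nb j, k ≤ ((T.nb j).erase i).card) (h : ℕ) (i : Fin N) (j : Fin J) :
    0 < T.msg k z h i j := by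
  induction h generalizing i j with
  | zero => exact hz i
  | succ h ih =>
    refine mul_pos (hz i) (Finset.prod_pos fun j' hj' => ?_)
    obtain ⟨S, hS⟩ := Finset.powersetCard_nonempty.2
      (hk j' i (mem_checks.1 (Finset.mem_of_mem_erase hj')))
    exact (Finset.prod_pos fun i' _ => ih i' j').trans_le
      (Finset.le_sup (f := fun S => ∏ i' ∈ S, T.msg k z h i' j') hS)

/-- If all messages are less than one, then the cost vector `-log z` is positive on the nonzero
points of the polytope. -/
theorem sum_neg_log_mul_pos (T : TannerCode N J) {dL dR d : ℕ} (hd : 2 ≤ d) (hdL : 1 ≤ dL)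
    (hL : ∀ i, (T.checks i).card = dL) (hR : ∀ j, (T.nb j).card = dR)
    (hT : (d : ℕ∞) ≤ T.minLocalDist) {z : Fin N → ℝ≥0} (hz : ∀ i, 0 < z i) (h : ℕ)
    (hmsg : ∀ i, ∀ j ∈ T.checks i, T.msg (d - 1) z h i j < 1)
    {x : Fin N → ℝ} (hx : x ∈ T.polytope) (hx0 : x ≠ 0) :
    0 < ∑ i, -Real.log (z i) * x i := by
  have hxj : ∀ j, x ∈ convexHull ℝ (bitsToReal '' T.extendedCode j) := Set.mem_iInter.1 hx
  choose M hsymm hdiag hM0 hMx hMsum using fun j => T.exists_pairing j d hd hT x (hxj j)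
  have hne : ∀ i, (T.checks i).Nonempty := fun i => Finset.card_pos.1 (by rw [hL]; omega)
  have hxnn : ∀ i, 0 ≤ x i := fun i => by
    obtain ⟨j, -⟩ := hne i
    exact T.nonneg_of_mem_convexHull j x (hxj j) i
  obtain ⟨i₀, hi₀⟩ : ∃ i, 0 < x i := by
    by_contra! hcon
    exact hx0 (funext fun i => le_antisymm (hcon i) (hxnn i))
  have hMerase : ∀ j, ∀ i ∈ T.nb j, ∑ b ∈ (T.nb j).erase i, M j i b = ((d - 1 : ℕ) : ℝ) * x i := by
    intro j i hi
    rw [Finset.sum_erase _ (hdiag j i), hMsum j i hi]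
  -- Applied to the zero functional, the hypersimplex lemma just exhibits d - 1 further neighbours;
  -- regularity carries this to every local-code node.
  have hddR : d - 1 ≤ dR - 1 := by
    obtain ⟨j, hj⟩ := hne i₀
    have hj := mem_checks.1 hj
    obtain ⟨S, hS, -⟩ := exists_powersetCard_mul_sum_le ((T.nb j).erase i₀) (d - 1) (M j i₀) 0 (x i₀)
      hi₀ (fun b _ => hM0 j _ b) (fun b _ => hMx j _ b) (hMerase j i₀ hj)
    have := Finset.powersetCard_nonempty.1 ⟨S, hS⟩
    rwa [Finset.card_erase_of_mem hj, hR] at this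
  have hk : ∀ j, ∀ i ∈ T.nb j, d - 1 ≤ ((T.nb j).erase i).card := by
    intro j i hi
    rw [Finset.card_erase_of_mem hi, hR]
    exact hddR
  have hpos := fun h => T.msg_pos hz hk h
  set C : ℝ := ∑ i, -Real.log (z i) * x i with hC
  set f : ℕ → Fin N → Fin J → ℝ := fun h i j => -Real.log (T.msg (d - 1) z h i j) with hf
  -- Row i of the pair weights lies in a hypersimplex dilated by x i, so its cost is at least x i
  -- times that of the cheapest d - 1 neighbours.
  have hlocal : ∀ h i j, i ∈ T.nb j →
      x i * -Real.log (maxProd (d - 1) ((T.nb j).erase i) fun i' => T.msg (d - 1) z h i' j) ≤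
        ∑ b ∈ T.nb j, M j i b * f h b j := by
    intro h i j hi
    rcases (hxnn i).eq_or_lt with h0 | h0
    · have : ∀ b, M j i b = 0 := fun b => le_antisymm (h0 ▸ hMx j i b) (hM0 j i b)
      simp [← h0, this]
    obtain ⟨S, hS, hle⟩ := exists_powersetCard_mul_sum_le ((T.nb j).erase i) (d - 1) (M j i)
      (fun b => f h b j) (x i) h0 (fun b _ => hM0 j _ b) (fun b _ => hMx j _ b) (hMerase j i hi)
    rw [Finset.sum_erase _ (by rw [hdiag, zero_mul])] at hle
    refine le_trans (mul_le_mul_of_nonneg_left ?_ h0.le) hle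
    rw [hf]
    simp only [Finset.sum_neg_distrib]
    rw [neg_le_neg_iff, ← Real.log_prod fun b _ => ne_of_gt (by exact_mod_cast hpos h b j)]
    refine Real.log_le_log (Finset.prod_pos fun b _ => by exact_mod_cast hpos h b j) ?_
    have := Finset.le_sup (f := fun S => ∏ i' ∈ S, T.msg (d - 1) z h i' j) hS
    exact_mod_cast this
  have hstep : ∀ h, ∑ i, ∑ j ∈ T.checks i, x i * f (h + 1) i j ≤
      dL * C + ((dL : ℝ) - 1) * ((d - 1 : ℕ) * ∑ i, ∑ j ∈ T.checks i, x i * f h i j) := by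
    intro h
    set A : Fin N → Fin J → ℝ := fun i j =>
      -Real.log (maxProd (d - 1) ((T.nb j).erase i) fun i' => T.msg (d - 1) z h i' j) with hA
    have e1 : ∀ i j, f (h + 1) i j = -Real.log (z i) + ∑ j' ∈ (T.checks i).erase j, A i j' := by
      intro i j
      have hp : ∀ j' ∈ (T.checks i).erase j, ((maxProd (d - 1) ((T.nb j').erase i)
          fun i' => T.msg (d - 1) z h i' j' : ℝ≥0) : ℝ) ≠ 0 := by
        intro j' hj'
        obtain ⟨S, hS⟩ := Finset.powersetCard_nonempty.2
          (hk j' i (mem_checks.1 (Finset.mem_of_mem_erase hj')))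
        have := (Finset.prod_pos fun i' _ => hpos h i' j').trans_le
          (Finset.le_sup (f := fun S => ∏ i' ∈ S, T.msg (d - 1) z h i' j') hS)
        exact_mod_cast this.ne'
      simp only [hf, hA, msg, NNReal.coe_mul, NNReal.coe_prod, Finset.sum_neg_distrib]
      rw [Real.log_mul (by exact_mod_cast (hz i).ne') (Finset.prod_ne_zero_iff.2 hp),
        Real.log_prod hp]
      ring
    have e2 : ∀ i, ∑ j ∈ T.checks i, x i * f (h + 1) i j =
        dL * (-Real.log (z i) * x i) + ((dL : ℝ) - 1) * ∑ j ∈ T.checks i, x i * A i j := by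
      intro i
      have : ∑ j ∈ T.checks i, ∑ j' ∈ (T.checks i).erase j, A i j' =
          ((dL : ℝ) - 1) * ∑ j ∈ T.checks i, A i j := by
        rw [Finset.sum_congr rfl fun j hj => eq_sub_of_add_eq (Finset.sum_erase_add _ (A i) hj),
          Finset.sum_sub_distrib, Finset.sum_const, hL, nsmul_eq_mul]
        ring
      rw [← Finset.mul_sum, Finset.sum_congr rfl fun j _ => e1 i j, Finset.sum_add_distrib, this,
        Finset.sum_const, hL, nsmul_eq_mul, ← Finset.mul_sum]
      ring
    rw [Finset.sum_congr rfl fun i _ => e2 i, Finset.sum_add_distrib, ← Finset.mul_sum,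
      ← Finset.mul_sum, ← hC]
    have hd1 : (0 : ℝ) ≤ (dL : ℝ) - 1 := sub_nonneg.2 (by exact_mod_cast hdL)
    gcongr
    rw [sum_checks_comm, sum_checks_comm, Finset.mul_sum]
    refine Finset.sum_le_sum fun j _ => (Finset.sum_le_sum fun i hi => hlocal h i j hi).trans_eq ?_
    -- By symmetry of M the column sums are also (d-1) x b, so the cost of each incoming message is
    -- collected with exactly this weight.
    rw [Finset.sum_comm, Finset.mul_sum]
    refine Finset.sum_congr rfl fun b hb => ?_
    rw [← Finset.sum_mul, Finset.sum_congr rfl fun a _ => hsymm j a b, hMsum j b hb]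
    ring
  have hbound : ∀ h, ∃ A : ℝ, 0 ≤ A ∧ ∑ i, ∑ j ∈ T.checks i, x i * f h i j ≤ A * C := by
    intro h
    induction h with
    | zero =>
      refine ⟨dL, by positivity, le_of_eq ?_⟩
      simp only [hf, msg, Finset.sum_const, hL, nsmul_eq_mul]
      rw [← Finset.mul_sum, hC]
      congr 1
      exact Finset.sum_congr rfl fun i _ => mul_comm _ _
    | succ h ih =>
      obtain ⟨A, hA, hle⟩ := ih
      have hd1 : (0 : ℝ) ≤ (dL : ℝ) - 1 := sub_nonneg.2 (by exact_mod_cast hdL)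
      refine ⟨dL + ((dL : ℝ) - 1) * ((d - 1 : ℕ) * A), by positivity, (hstep h).trans ?_⟩
      rw [add_mul, mul_assoc ((dL : ℝ) - 1), mul_assoc ((d - 1 : ℕ) : ℝ)]
      gcongr
  obtain ⟨A, hA, hle⟩ := hbound h
  have hfpos : ∀ i, ∀ j ∈ T.checks i, 0 < f h i j := fun i j hj =>
    neg_pos.2 (Real.log_neg (by exact_mod_cast hpos h i j) (by exact_mod_cast hmsg i j hj))
  have hSpos : 0 < ∑ i, ∑ j ∈ T.checks i, x i * f h i j := by
    refine Finset.sum_pos' (fun i _ => Finset.sum_nonneg fun j hj =>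
      mul_nonneg (hxnn i) (hfpos i j hj).le) ⟨i₀, Finset.mem_univ _, ?_⟩
    exact Finset.sum_pos (fun j hj => mul_pos hi₀ (hfpos i₀ j hj)) (hne i₀)
  exact pos_of_mul_pos_right (hSpos.trans_le hle) hA

end TannerCode

/-! ### Girth and the locality of messages -/

/-- Two distinct paths with the same ends span a cycle. -/
theorem SimpleGraph.egirth_le_of_isPath_ne {V : Type*} {G : SimpleGraph V} {u v : V}
    {p q : G.Walk u v} (hp : p.IsPath) (hq : q.IsPath) (hpq : p ≠ q) :
    G.egirth ≤ (p.length + q.length : ℕ) := by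
  classical
  -- The union of the two paths is not a forest, since paths in a forest are unique; a cycle in it
  -- uses only edges of p and q, each at most once.
  set H : SimpleGraph V := SimpleGraph.fromEdgeSet {e | e ∈ p.edges ∨ e ∈ q.edges} with hH
  have hpe : ∀ e ∈ p.edges, e ∈ H.edgeSet := fun e he => by
    rw [hH, SimpleGraph.edgeSet_fromEdgeSet]
    exact ⟨Or.inl he, G.not_isDiag_of_mem_edgeSet (p.edges_subset_edgeSet he)⟩
  have hqe : ∀ e ∈ q.edges, e ∈ H.edgeSet := fun e he => by
    rw [hH, SimpleGraph.edgeSet_fromEdgeSet]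
    exact ⟨Or.inr he, G.not_isDiag_of_mem_edgeSet (q.edges_subset_edgeSet he)⟩
  have hHG : H ≤ G := by
    intro a b hab
    rcases ((SimpleGraph.fromEdgeSet_adj _).1 hab).1 with h | h
    · exact p.edges_subset_edgeSet h
    · exact q.edges_subset_edgeSet h
  have hcyc : ¬ H.IsAcyclic := by
    intro hac
    have heq := (hac.subsingleton_path u v).elim ⟨p.transfer H hpe, hp.transfer hpe⟩
      ⟨q.transfer H hqe, hq.transfer hqe⟩
    have h2 := congrArg (fun w : H.Walk u v => w.support) (congrArg Subtype.val heq)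
    simp only [SimpleGraph.Walk.support_transfer] at h2
    exact hpq (SimpleGraph.Walk.ext_support h2)
  simp only [SimpleGraph.IsAcyclic, not_forall, not_not] at hcyc
  obtain ⟨a, w, hw⟩ := hcyc
  refine (SimpleGraph.egirth_le_length (hw.mapLe hHG)).trans ?_
  have hsub : w.edges ⊆ p.edges ++ q.edges := by
    intro e he
    have := w.edges_subset_edgeSet he
    rw [hH, SimpleGraph.edgeSet_fromEdgeSet] at this
    exact List.mem_append.2 this.1
  have hlen := (List.subperm_of_subset hw.edges_nodup hsub).length_le
  rw [List.length_append, SimpleGraph.Walk.length_edges, SimpleGraph.Walk.length_edges,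
    SimpleGraph.Walk.length_edges] at hlen
  rw [SimpleGraph.Walk.length_map]
  exact_mod_cast hlen

namespace TannerCode

variable {N J : ℕ}

theorem graph_adj_inl_inr {T : TannerCode N J} {i : Fin N} {j : Fin J} :
    T.graph.Adj (Sum.inl i) (Sum.inr j) ↔ i ∈ T.nb j := by
  rw [mem_nb_iff_range]
  simp [graph, SimpleGraph.fromRel_adj, eq_comm]

theorem card_checks {T : TannerCode N J} {dL dR : ℕ} (hT : T.IsRegular dL dR) (i : Fin N) :
    (T.checks i).card = dL := by
  rw [← hT.1 i, ← Set.ncard_coe_finset, ← Set.ncard_image_of_injective _ Sum.inr_injective]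
  congr 1
  ext (a | a)
  · simp [graph, SimpleGraph.fromRel_adj]
  · simp [graph_adj_inl_inr, mem_checks]

theorem card_nb {T : TannerCode N J} {dL dR : ℕ} (hT : T.IsRegular dL dR) (j : Fin J) :
    (T.nb j).card = dR := by
  rw [← hT.2 j, ← Set.ncard_coe_finset, ← Set.ncard_image_of_injective _ Sum.inl_injective]
  congr 1
  ext (a | a)
  · simp [← graph_adj_inl_inr, SimpleGraph.adj_comm]
  · simp [graph, SimpleGraph.fromRel_adj]

/-- The variable nodes within distance `2 * h` of `i` in the graph without `j`. -/
def reach (T : TannerCode N J) (h : ℕ) (i : Fin N) (j : Fin J) : Set (Fin N) :=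
  {u | ∃ p : T.graph.Walk (Sum.inl i) (Sum.inl u), p.IsPath ∧ p.length ≤ 2 * h ∧
    Sum.inr j ∉ p.support}

theorem self_mem_reach (T : TannerCode N J) (h : ℕ) (i : Fin N) (j : Fin J) : i ∈ T.reach h i j :=
  ⟨SimpleGraph.Walk.nil, by simp⟩

/-- Prepend i, j', i' to the path from i' to u. If i were already on it, its initial part and i',
j', i would give a cycle of length at most 2h+2; if another neighbour j of i were on the new path,
the edge from i to j would close one of length at most 2h+3. -/
theorem exists_isPath_of_mem_reach {T : TannerCode N J} {h : ℕ} {i i' u : Fin N} {j' : Fin J}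
    (hg : ((2 * h + 3 : ℕ) : ℕ∞) < T.graph.egirth) (hi : i ∈ T.nb j') (hi' : i' ∈ (T.nb j').erase i)
    (hu : u ∈ T.reach h i' j') :
    ∃ p : T.graph.Walk (Sum.inl i) (Sum.inl u), p.IsPath ∧ p.length ≤ 2 * (h + 1) ∧
      ∃ l, p.support = Sum.inl i :: Sum.inr j' :: Sum.inl i' :: l ∧
        ∀ j ∈ T.checks i, j ≠ j' → Sum.inr j ∉ p.support := by
  obtain ⟨p, hp, hlen, hj'⟩ := hu
  obtain ⟨hne, hi'⟩ := Finset.mem_erase.1 hi'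
  have a1 : T.graph.Adj (Sum.inl i) (Sum.inr j') := graph_adj_inl_inr.2 hi
  have a2 : T.graph.Adj (Sum.inr j') (Sum.inl i') := (graph_adj_inl_inr.2 hi').symm
  have hp2 : (SimpleGraph.Walk.cons a2 p).IsPath := hp.cons hj'
  have hi0 : Sum.inl i ∉ p.support := by
    intro hmem
    have hle := p.length_takeUntil_le_length hmem
    have hq : (SimpleGraph.Walk.cons a2.symm (SimpleGraph.Walk.cons a1.symm
        SimpleGraph.Walk.nil)).IsPath := by
      simp [SimpleGraph.Walk.isPath_def, hne]
    have := SimpleGraph.egirth_le_of_isPath_ne (hp.takeUntil hmem) hq (fun heq => hj' (by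
      refine p.support_takeUntil_subset_support hmem ?_
      rw [heq]; simp))
    refine absurd (this.trans ?_) (not_le.2 hg)
    simp only [SimpleGraph.Walk.length_cons, SimpleGraph.Walk.length_nil]
    exact_mod_cast (by omega)
  have hp3 : (SimpleGraph.Walk.cons a1 (SimpleGraph.Walk.cons a2 p)).IsPath :=
    hp2.cons (by simp [hi0])
  refine ⟨_, hp3, by simp; omega, p.support.tail, by simp, ?_⟩
  intro j hj hjj hmem
  have a3 : T.graph.Adj (Sum.inl i) (Sum.inr j) := graph_adj_inl_inr.2 (mem_checks.1 hj)
  set P := SimpleGraph.Walk.cons a1 (SimpleGraph.Walk.cons a2 p) with hP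
  have hq : (SimpleGraph.Walk.cons a3 SimpleGraph.Walk.nil).IsPath := by
    simp [SimpleGraph.Walk.isPath_def]
  have hle := P.length_takeUntil_le_length hmem
  have := SimpleGraph.egirth_le_of_isPath_ne (hp3.takeUntil hmem) hq (fun heq => by
    have h2 : (P.takeUntil _ hmem).getVert 1 = P.getVert 1 := P.getVert_takeUntil hmem (by simp [heq])
    rw [heq] at h2
    simp [hP] at h2
    exact hjj h2)
  refine absurd (this.trans ?_) (not_le.2 hg)
  simp only [SimpleGraph.Walk.length_cons, SimpleGraph.Walk.length_nil]
  have : P.length = p.length + 2 := by simp [hP]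
  exact_mod_cast (by omega)

theorem reach_subset {T : TannerCode N J} {h : ℕ} {i i' : Fin N} {j j' : Fin J}
    (hg : ((2 * h + 3 : ℕ) : ℕ∞) < T.graph.egirth) (hj : j ∈ T.checks i)
    (hj' : j' ∈ (T.checks i).erase j) (hi' : i' ∈ (T.nb j').erase i) :
    T.reach h i' j' ⊆ T.reach (h + 1) i j := by
  intro u hu
  obtain ⟨hne, hj'⟩ := Finset.mem_erase.1 hj'
  obtain ⟨p, hp, hlen, -, -, hav⟩ := exists_isPath_of_mem_reach hg (mem_checks.1 hj') hi' hu
  exact ⟨p, hp, hlen, hav j hj hne.symm⟩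

theorem notMem_reach {T : TannerCode N J} {h : ℕ} {i i' : Fin N} {j' : Fin J}
    (hg : ((2 * h + 3 : ℕ) : ℕ∞) < T.graph.egirth) (hi : i ∈ T.nb j')
    (hi' : i' ∈ (T.nb j').erase i) : i ∉ T.reach h i' j' := by
  intro hu
  obtain ⟨p, hp, hlen, l, hl, -⟩ := exists_isPath_of_mem_reach hg hi hi' hu
  rw [(SimpleGraph.Walk.isPath_iff_nil.1 hp).eq_nil] at hl
  simp at hl

/-- A common vertex would be joined to i by two paths of length at most 2h+2 that begin differently,
giving a cycle of length at most 4h+4. -/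
theorem disjoint_reach {T : TannerCode N J} {h : ℕ} {i i' i'' : Fin N} {j' j'' : Fin J}
    (hg : ((4 * h + 4 : ℕ) : ℕ∞) < T.graph.egirth) (hi1 : i ∈ T.nb j') (hi2 : i ∈ T.nb j'')
    (hi' : i' ∈ (T.nb j').erase i) (hi'' : i'' ∈ (T.nb j'').erase i)
    (hne : (j', i') ≠ (j'', i'')) : Disjoint (T.reach h i' j') (T.reach h i'' j'') := by
  have hg' : ((2 * h + 3 : ℕ) : ℕ∞) < T.graph.egirth :=
    lt_of_le_of_lt (by exact_mod_cast (by omega)) hg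
  rw [Set.disjoint_left]
  intro u hu1 hu2
  obtain ⟨p, hp, hlen, l, hl, -⟩ := exists_isPath_of_mem_reach hg' hi1 hi' hu1
  obtain ⟨q, hq, hlen', l', hl', -⟩ := exists_isPath_of_mem_reach hg' hi2 hi'' hu2
  have := SimpleGraph.egirth_le_of_isPath_ne hp hq (fun heq => hne (by
    rw [heq, hl'] at hl
    simp at hl
    simp [hl.1, hl.2.1]))
  refine absurd (this.trans ?_) (not_le.2 hg)
  exact_mod_cast (by omega)

/-- Along the recursion the sets `reach` are nested, by `reach_subset`. With `disjoint_reach` this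
converts large girth into independence of messages. -/
theorem dependsOn_msg (T : TannerCode N J) (k h : ℕ) (i : Fin N) (j : Fin J)
    (hg : ((4 * h : ℕ) : ℕ∞) < T.graph.egirth) (hj : j ∈ T.checks i) :
    DependsOn (fun z => T.msg k z h i j) (T.reach h i j) := by
  induction h generalizing i j with
  | zero => exact fun z z' hz => hz i (T.self_mem_reach 0 i j)
  | succ h ih =>
    have hg2 : ((4 * h : ℕ) : ℕ∞) < T.graph.egirth :=
      lt_of_le_of_lt (by exact_mod_cast (by omega)) hg
    have hg3 : ((2 * h + 3 : ℕ) : ℕ∞) < T.graph.egirth :=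
      lt_of_le_of_lt (by exact_mod_cast (by omega)) hg
    intro z z' hz
    simp only [msg, maxProd]
    rw [hz i (T.self_mem_reach _ i j)]
    congr 1
    refine Finset.prod_congr rfl fun j' hj' => Finset.sup_congr rfl fun S hS =>
      Finset.prod_congr rfl fun i' hi' => ?_
    have hi' := (Finset.mem_powersetCard.1 hS).1 hi'
    exact ih i' j' hg2 (mem_checks.2 (Finset.mem_of_mem_erase hi')) fun u hu =>
      hz u (reach_subset hg3 hj hj' hi' hu)

/-- Serves both for measurability and for perturbing zero entries of z to positive ones. -/
theorem continuous_msg (T : TannerCode N J) (k h : ℕ) (i : Fin N) (j : Fin J) :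
    Continuous fun z => T.msg k z h i j := by
  induction h generalizing i j with
  | zero => exact continuous_apply i
  | succ h ih =>
    simp only [msg, maxProd]
    refine (continuous_apply i).mul (continuous_finsetProd _ fun j' _ => ?_)
    exact Continuous.finset_sup_apply fun S _ => continuous_finsetProd _ fun i' _ => ih i' j'

end TannerCode

/-! ### Independence and expected messages -/

theorem DependsOn.finsetProd {ι κ α β : Type*} [CommMonoid β] {f : κ → (ι → α) → β} {s : Finset κ}
    {D : κ → Set ι} (hf : ∀ a ∈ s, DependsOn (f a) (D a)) :
    DependsOn (fun z => ∏ a ∈ s, f a z) (⋃ a ∈ s, D a) := fun _ _ h =>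
  Finset.prod_congr rfl fun a ha => hf a ha fun i hi => h i (Set.mem_biUnion ha hi)

/-- Functions of disjoint blocks of coordinates are independent. -/
theorem lintegral_mul_of_dependsOn {ι α : Type*} [Fintype ι] [MeasurableSpace α] [Nonempty α]
    (ρ : Measure α) [IsProbabilityMeasure ρ] {f g : (ι → α) → ℝ≥0∞} (hf : Measurable f)
    (hg : Measurable g) {S T : Set ι} (hfS : DependsOn f S) (hgT : DependsOn g T)
    (hST : Disjoint S T) :
    ∫⁻ z, f z * g z ∂(Measure.pi fun _ => ρ) =
      (∫⁻ z, f z ∂(Measure.pi fun _ => ρ)) * ∫⁻ z, g z ∂(Measure.pi fun _ => ρ) := by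
  classical
  obtain ⟨a₀⟩ := ‹Nonempty α›
  have hext : ∀ (U : Set ι) (F : (ι → α) → ℝ≥0∞), Measurable F → DependsOn F U →
      ∃ G : (U.toFinset → α) → ℝ≥0∞, Measurable G ∧ F = fun z => G fun i => z i := by
    intro U F hF hFU
    refine ⟨fun v => F fun i => if h : i ∈ U.toFinset then v ⟨i, h⟩ else a₀, hF.comp ?_, ?_⟩
    · refine measurable_pi_lambda _ fun i => ?_
      by_cases h : i ∈ U.toFinset
      · simp only [h, dite_true]
        exact measurable_pi_apply _
      · simp only [h, dite_false]
        exact measurable_const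
    · funext z
      exact hFU fun i hi => by simp [hi]
  obtain ⟨f', hf', rfl⟩ := hext S f hf hfS
  obtain ⟨g', hg', rfl⟩ := hext T g hg hgT
  have hind := (ProbabilityTheory.iIndepFun_pi (μ := fun _ : ι => ρ) (X := fun _ => id)
    fun _ => aemeasurable_id).indepFun_finset S.toFinset T.toFinset
    (by rwa [Set.disjoint_toFinset]) fun i => measurable_pi_apply i
  exact ProbabilityTheory.lintegral_mul_eq_lintegral_mul_lintegral_of_indepFun hf hg
    (hind.comp hf' hg')

theorem lintegral_prod_of_dependsOn {ι α κ : Type*} [Fintype ι] [MeasurableSpace α] [Nonempty α]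
    (ρ : Measure α) [IsProbabilityMeasure ρ] (s : Finset κ) (f : κ → (ι → α) → ℝ≥0∞)
    (D : κ → Set ι) (hf : ∀ a ∈ s, Measurable (f a)) (hD : ∀ a ∈ s, DependsOn (f a) (D a))
    (hdisj : (s : Set κ).PairwiseDisjoint D) :
    ∫⁻ z, ∏ a ∈ s, f a z ∂(Measure.pi fun _ => ρ) =
      ∏ a ∈ s, ∫⁻ z, f a z ∂(Measure.pi fun _ => ρ) := by
  classical
  induction s using Finset.induction_on with
  | empty => simp
  | insert a s ha ih =>
    simp only [Finset.prod_insert ha]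
    rw [← ih (fun b hb => hf b (Finset.mem_insert_of_mem hb))
      (fun b hb => hD b (Finset.mem_insert_of_mem hb)) (hdisj.subset (by simp))]
    refine lintegral_mul_of_dependsOn ρ (hf a (Finset.mem_insert_self a s))
      (Finset.measurable_fun_prod _ fun b hb => hf b (Finset.mem_insert_of_mem hb))
      (hD a (Finset.mem_insert_self a s))
      (DependsOn.finsetProd fun b hb => hD b (Finset.mem_insert_of_mem hb)) ?_
    refine Set.disjoint_iUnion₂_right.2 fun b hb => hdisj (by simp) (by simp [hb]) ?_
    rintro rfl
    exact ha hb

theorem coe_maxProd_le_sum {ι : Type*} (k : ℕ) (s : Finset ι) (z : ι → ℝ≥0) :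
    (maxProd k s z : ℝ≥0∞) ≤ ∑ S ∈ s.powersetCard k, ∏ i ∈ S, (z i : ℝ≥0∞) := by
  have h : maxProd k s z ≤ ∑ S ∈ s.powersetCard k, ∏ i ∈ S, z i :=
    Finset.sup_le fun S hS => Finset.single_le_sum (f := fun S => ∏ i ∈ S, z i)
      (fun _ _ => zero_le) hS
  calc (maxProd k s z : ℝ≥0∞) ≤ ((∑ S ∈ s.powersetCard k, ∏ i ∈ S, z i : ℝ≥0) : ℝ≥0∞) := by
        exact_mod_cast h
    _ = _ := by push_cast; rfl

theorem continuous_maxProd {ι : Type*} (k : ℕ) (s : Finset ι) :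
    Continuous fun z : ι → ℝ≥0 => maxProd k s z :=
  Continuous.finset_sup_apply fun _ _ => continuous_finsetProd _ fun i _ => continuous_apply i

theorem maxProd_map {ι κ : Type*} (k : ℕ) (s : Finset ι) (e : ι ↪ κ) (z : κ → ℝ≥0) :
    maxProd k (s.map e) z = maxProd k s fun i => z (e i) := by
  simp [maxProd, Finset.powersetCard_map, Finset.sup_map, Function.comp_def, Finset.prod_map]

/-- The expectation of `maxProd` only depends on the number of variables. -/
theorem lintegral_maxProd {ι : Type*} [Fintype ι] (ρ : Measure ℝ≥0) [IsProbabilityMeasure ρ] (k : ℕ)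
    (s : Finset ι) {n : ℕ} (hn : s.card = n) :
    ∫⁻ z, (maxProd k s z : ℝ≥0∞) ∂(Measure.pi fun _ : ι => ρ) =
      ∫⁻ z, (maxProd k Finset.univ z : ℝ≥0∞) ∂(Measure.pi fun _ : Fin n => ρ) := by
  classical
  subst hn
  set e : Fin s.card ↪ ι := s.equivFin.symm.toEmbedding.trans (Function.Embedding.subtype _)
  have hs : s = Finset.univ.map e := by
    rw [← Finset.map_map, Finset.map_univ_equiv]
    exact Finset.attach_map_val.symm
  have hind := (ProbabilityTheory.iIndepFun_pi (μ := fun _ : ι => ρ) (X := fun _ => id)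
    fun _ => aemeasurable_id).precomp e.injective
  have hmap := (ProbabilityTheory.iIndepFun_iff_map_fun_eq_pi_map
    fun a => (measurable_pi_apply (e a)).aemeasurable).1 hind
  have hmarg : ∀ a, (Measure.pi fun _ : ι => ρ).map (fun z => z (e a)) = ρ := fun a =>
    (measurePreserving_eval (fun _ : ι => ρ) (e a)).map_eq
  simp only [hmarg] at hmap
  rw [← hmap, lintegral_map (continuous_maxProd _ _).measurable.coe_nnreal_ennreal
    (measurable_pi_lambda _ fun a => measurable_pi_apply (e a))]
  conv_lhs => rw [hs]
  simp only [maxProd_map]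

namespace TannerCode

variable {N J : ℕ}

/-- The upper bounds of the expected messages after local-code nodes. -/
def checkBound (dL k : ℕ) (c g b : ℝ≥0∞) : ℕ → ℝ≥0∞
  | 0 => b
  | h + 1 => c * (g * checkBound dL k c g b h ^ (dL - 1)) ^ k

theorem measurable_msg (T : TannerCode N J) (k h : ℕ) (i : Fin N) (j : Fin J) :
    Measurable fun z => (T.msg k z h i j : ℝ≥0∞) :=
  (T.continuous_msg k h i j).measurable.coe_nnreal_ennreal

/-- A maximum is at most the sum over all k-subsets, which produces the binomial factor; within a
subset the messages are independent. -/
theorem lintegral_maxProd_msg_le (T : TannerCode N J) {dR k h : ℕ} (ρ : Measure ℝ≥0)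
    [IsProbabilityMeasure ρ] (hR : ∀ j, (T.nb j).card = dR)
    (hg : ((4 * h + 4 : ℕ) : ℕ∞) < T.graph.egirth) {α : ℝ≥0∞}
    (hα : ∀ i, ∀ j ∈ T.checks i,
      ∫⁻ z, (T.msg k z h i j : ℝ≥0∞) ∂(Measure.pi fun _ => ρ) ≤ α)
    {i : Fin N} {j : Fin J} (hj : j ∈ T.checks i) :
    ∫⁻ z, (maxProd k ((T.nb j).erase i) fun i' => T.msg k z h i' j : ℝ≥0)
      ∂(Measure.pi fun _ => ρ) ≤ (dR - 1).choose k * α ^ k := by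
  have hi := mem_checks.1 hj
  have hg' : ((4 * h : ℕ) : ℕ∞) < T.graph.egirth := lt_of_le_of_lt (by exact_mod_cast (by omega)) hg
  refine (lintegral_mono fun z => coe_maxProd_le_sum k _ _).trans ?_
  rw [lintegral_finsetSum _ fun S _ =>
    Finset.measurable_fun_prod S fun i' _ => T.measurable_msg k h i' j]
  have hcard : ((T.nb j).erase i).card = dR - 1 := by rw [Finset.card_erase_of_mem hi, hR]
  refine (Finset.sum_le_card_nsmul _ _ (α ^ k) fun S hS => ?_).trans_eq (by
    rw [Finset.card_powersetCard, hcard, nsmul_eq_mul])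
  obtain ⟨hSs, hSk⟩ := Finset.mem_powersetCard.1 hS
  have hmem : ∀ i' ∈ S, i' ∈ T.nb j := fun i' hi' => Finset.mem_of_mem_erase (hSs hi')
  rw [lintegral_prod_of_dependsOn ρ S (fun i' z => (T.msg k z h i' j : ℝ≥0∞))
    (fun i' => T.reach h i' j) (fun i' _ => T.measurable_msg k h i' j)
    (fun i' hi' z z' hz => congrArg _ (T.dependsOn_msg k h i' j hg' (mem_checks.2 (hmem i' hi')) hz))
    (fun a ha b hb hab => disjoint_reach hg hi hi (hSs ha) (hSs hb) (by simp [hab]))]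
  exact (Finset.prod_le_pow_card _ _ α fun i' hi' => hα i' j (mem_checks.2 (hmem i' hi'))).trans_eq
    (by rw [hSk])

/-- The symbol at i and the factors of the dL - 1 local-code nodes other than j read disjoint sets
of symbols, so the expectation factorises. -/
theorem lintegral_msg_succ_le_of_le (T : TannerCode N J) {dL k h : ℕ} (ρ : Measure ℝ≥0)
    [IsProbabilityMeasure ρ] (hL : ∀ i, (T.checks i).card = dL)
    (hg : ((4 * h + 4 : ℕ) : ℕ∞) < T.graph.egirth) {β : ℝ≥0∞}
    (hβ : ∀ i, ∀ j ∈ T.checks i,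
      ∫⁻ z, (maxProd k ((T.nb j).erase i) fun i' => T.msg k z h i' j : ℝ≥0)
        ∂(Measure.pi fun _ => ρ) ≤ β)
    {i : Fin N} {j : Fin J} (hj : j ∈ T.checks i) :
    ∫⁻ z, (T.msg k z (h + 1) i j : ℝ≥0∞) ∂(Measure.pi fun _ => ρ) ≤
      (∫⁻ a, (a : ℝ≥0∞) ∂ρ) * β ^ (dL - 1) := by
  have hg' : ((4 * h : ℕ) : ℕ∞) < T.graph.egirth := lt_of_le_of_lt (by exact_mod_cast (by omega)) hg
  have hg3 : ((2 * h + 3 : ℕ) : ℕ∞) < T.graph.egirth :=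
    lt_of_le_of_lt (by exact_mod_cast (by omega)) hg
  set F : Fin J → (Fin N → ℝ≥0) → ℝ≥0∞ := fun j' z =>
    (maxProd k ((T.nb j').erase i) fun i' => T.msg k z h i' j' : ℝ≥0) with hF
  set D : Fin J → Set (Fin N) := fun j' => ⋃ i' ∈ (T.nb j').erase i, T.reach h i' j' with hD
  have hFm : ∀ j', Measurable (F j') := fun j' => ((continuous_maxProd k _).comp
    (continuous_pi fun i' => T.continuous_msg k h i' j')).measurable.coe_nnreal_ennreal
  have hFD : ∀ j', DependsOn (F j') (D j') := by
    intro j' z z' hz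
    refine congrArg ENNReal.ofNNReal (Finset.sup_congr rfl fun S hS => Finset.prod_congr rfl fun i' hi' => ?_)
    have hi' := (Finset.mem_powersetCard.1 hS).1 hi'
    exact T.dependsOn_msg k h i' j' hg' (mem_checks.2 (Finset.mem_of_mem_erase hi'))
      fun u hu => hz u (Set.mem_biUnion (s := {i' | i' ∈ (T.nb j').erase i}) hi' hu)
  have hmem : ∀ j' ∈ (T.checks i).erase j, i ∈ T.nb j' := fun j' hj' =>
    mem_checks.1 (Finset.mem_of_mem_erase hj')
  have hdisj : (((T.checks i).erase j : Finset (Fin J)) : Set (Fin J)).PairwiseDisjoint D := by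
    intro a ha b hb hab
    refine Set.disjoint_iUnion₂_left.2 fun i' hi' => Set.disjoint_iUnion₂_right.2 fun i'' hi'' => ?_
    exact disjoint_reach hg (hmem a ha) (hmem b hb) hi' hi'' (by simp [hab])
  have hself : Disjoint {i} (⋃ j' ∈ (T.checks i).erase j, D j') := by
    refine Set.disjoint_iUnion₂_right.2 fun j' hj' => Set.disjoint_iUnion₂_right.2 fun i' hi' => ?_
    exact Set.disjoint_singleton_left.2 (notMem_reach hg3 (hmem j' hj') hi')
  have hmarg : ∫⁻ z : Fin N → ℝ≥0, (z i : ℝ≥0∞) ∂(Measure.pi fun _ => ρ) = ∫⁻ a, (a : ℝ≥0∞) ∂ρ :=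
    (measurePreserving_eval (fun _ : Fin N => ρ) i).lintegral_comp measurable_coe_nnreal_ennreal
  calc ∫⁻ z, (T.msg k z (h + 1) i j : ℝ≥0∞) ∂(Measure.pi fun _ => ρ)
      = ∫⁻ z, (z i : ℝ≥0∞) * ∏ j' ∈ (T.checks i).erase j, F j' z ∂(Measure.pi fun _ => ρ) := by
        simp only [msg, hF, ENNReal.coe_mul, ENNReal.ofNNReal_finsetProd]
    _ = (∫⁻ a, (a : ℝ≥0∞) ∂ρ) *
        ∏ j' ∈ (T.checks i).erase j, ∫⁻ z, F j' z ∂(Measure.pi fun _ => ρ) := by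
        rw [lintegral_mul_of_dependsOn ρ (measurable_pi_apply i).coe_nnreal_ennreal
          (Finset.measurable_fun_prod _ fun j' _ => hFm j') (S := {i})
          (fun z z' hz => by rw [hz i rfl]) (DependsOn.finsetProd fun j' _ => hFD j') hself,
          lintegral_prod_of_dependsOn ρ _ F D (fun j' _ => hFm j') (fun j' _ => hFD j') hdisj, hmarg]
    _ ≤ (∫⁻ a, (a : ℝ≥0∞) ∂ρ) * β ^ (dL - 1) := by
        gcongr
        rw [← hL i, ← Finset.card_erase_of_mem hj]
        exact Finset.prod_le_pow_card _ _ _ fun j' hj' => hβ i j' (Finset.mem_of_mem_erase hj')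

/-- The density-evolution bound for the expected messages in a graph of large girth. -/
theorem lintegral_msg_succ_le (T : TannerCode N J) {dL dR k : ℕ} (ρ : Measure ℝ≥0)
    [IsProbabilityMeasure ρ] (hL : ∀ i, (T.checks i).card = dL) (hR : ∀ j, (T.nb j).card = dR)
    (h : ℕ) (hg : ((4 * h + 4 : ℕ) : ℕ∞) < T.graph.egirth) (i : Fin N) (j : Fin J)
    (hj : j ∈ T.checks i) :
    ∫⁻ z, (T.msg k z (h + 1) i j : ℝ≥0∞) ∂(Measure.pi fun _ => ρ) ≤
      (∫⁻ a, (a : ℝ≥0∞) ∂ρ) * checkBound dL k ((dR - 1).choose k) (∫⁻ a, (a : ℝ≥0∞) ∂ρ)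
        (∫⁻ z, (maxProd k Finset.univ z : ℝ≥0∞) ∂(Measure.pi fun _ : Fin (dR - 1) => ρ)) h
          ^ (dL - 1) := by
  induction h generalizing i j with
  | zero =>
    -- At the leaves the expected maximum is kept exactly; this is the source of E e^{-tX₀} in the
    -- threshold.
    refine T.lintegral_msg_succ_le_of_le ρ hL hg (fun i j hj => le_of_eq ?_) hj
    exact lintegral_maxProd ρ k _ (by rw [Finset.card_erase_of_mem (mem_checks.1 hj), hR])
  | succ h ih =>
    refine T.lintegral_msg_succ_le_of_le ρ hL hg (fun i j hj => ?_) hj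
    exact T.lintegral_maxProd_msg_le ρ hR hg
      (ih (lt_of_le_of_lt (by exact_mod_cast (by omega)) hg)) hj

end TannerCode

/-! ### Decay of the density-evolution recursion -/

namespace TannerCode

theorem checkBound_succ (dL k : ℕ) (c g b : ℝ≥0∞) (h : ℕ) :
    checkBound dL k c g b (h + 1) = c * g ^ k * checkBound dL k c g b h ^ ((dL - 1) * k) := by
  rw [checkBound, mul_pow, ← pow_mul, mul_assoc]

/-- Below the threshold the density-evolution bounds decay doubly exponentially. -/
theorem exists_mul_checkBound_le {dL k : ℕ} {c g b p : ℝ≥0∞} (hdL : 2 ≤ dL) (hD : 2 ≤ (dL - 1) * k)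
    (hp : b * (c * g ^ k) ^ (1 / ((((dL - 1) * k : ℕ) : ℝ) - 1)) ≤ p) (hp1 : p < 1) :
    ∃ B : ℝ≥0, ∀ h : ℕ, 1 ≤ h →
      g * checkBound dL k c g b h ^ (dL - 1) ≤ B * p ^ 2 ^ h := by
  set D := (dL - 1) * k with hDdef
  set s : ℝ := 1 / ((D : ℝ) - 1) with hs
  set C := c * g ^ k with hC
  have hD1 : (0 : ℝ) < (D : ℝ) - 1 := by
    have : (2 : ℝ) ≤ D := by exact_mod_cast hD
    linarith
  have hs0 : 0 < s := by positivity
  have hsD : 1 + s = s * D := by rw [hs]; field_simp; ring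
  have hk : k ≠ 0 := by rintro rfl; simp [hDdef] at hD
  have hdL1 : dL - 1 ≠ 0 := by omega
  -- Multiplication by C^s turns the recursion u ↦ C u^D into v ↦ v^D, because 1 + s = s D.
  have hu : ∀ h, checkBound dL k c g b h * C ^ s ≤ p ^ D ^ h := by
    intro h
    induction h with
    | zero => simpa [checkBound] using hp
    | succ h ih =>
      calc checkBound dL k c g b (h + 1) * C ^ s
          = checkBound dL k c g b h ^ D * (C ^ (1 : ℝ) * C ^ s) := by
            rw [checkBound_succ, ENNReal.rpow_one]; ring
        _ = (checkBound dL k c g b h * C ^ s) ^ D := by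
            rw [← ENNReal.rpow_add_of_nonneg _ _ zero_le_one hs0.le, hsD, mul_pow,
              ENNReal.rpow_mul, ENNReal.rpow_natCast]
        _ ≤ (p ^ D ^ h) ^ D := by gcongr
        _ = p ^ D ^ (h + 1) := by rw [← pow_mul, pow_succ]
  have hzero : (∀ h, 1 ≤ h → checkBound dL k c g b h = 0) → ∃ B : ℝ≥0, ∀ h : ℕ, 1 ≤ h →
      g * checkBound dL k c g b h ^ (dL - 1) ≤ B * p ^ 2 ^ h := fun h0 =>
    ⟨0, fun h hh => by simp [h0 h hh, hdL1]⟩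
  -- For C = 0 the bounds vanish only from h = 1 on, whence the restriction 1 ≤ h. For C = ∞ the
  -- finite bound `hu` forces them all to vanish.
  rcases eq_or_ne C 0 with hC0 | hC0
  · refine hzero fun h hh => ?_
    obtain ⟨h, rfl⟩ := Nat.exists_eq_succ_of_ne_zero (by omega : h ≠ 0)
    rw [checkBound_succ, ← hC, hC0, zero_mul]
  rcases eq_or_ne C ∞ with hCt | hCt
  · refine hzero fun h _ => ?_
    by_contra hne
    have := hu h
    rw [hCt, ENNReal.top_rpow_of_pos hs0, ENNReal.mul_top hne, top_le_iff] at this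
    exact ENNReal.pow_ne_top (hp1.trans ENNReal.one_lt_top).ne this
  have hgt : g ≠ ∞ := by
    rintro rfl
    rw [hC, ENNReal.top_pow hk] at hC0 hCt
    exact hCt (ENNReal.mul_top (left_ne_zero_of_mul hC0))
  have hCs0 : C ^ s ≠ 0 := (ENNReal.rpow_pos (pos_iff_ne_zero.2 hC0) hCt).ne'
  have hCst : C ^ s ≠ ∞ := ENNReal.rpow_ne_top_of_nonneg hs0.le hCt
  have hBt : g * (C ^ s)⁻¹ ^ (dL - 1) ≠ ∞ :=
    ENNReal.mul_ne_top hgt (ENNReal.pow_ne_top (ENNReal.inv_ne_top.2 hCs0))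
  refine ⟨(g * (C ^ s)⁻¹ ^ (dL - 1)).toNNReal, fun h _ => ?_⟩
  rw [ENNReal.coe_toNNReal hBt, mul_assoc, ← mul_comm (p ^ 2 ^ h)]
  gcongr
  have h1 : checkBound dL k c g b h ≤ p ^ 2 ^ h * (C ^ s)⁻¹ := by
    rw [← div_eq_mul_inv, ENNReal.le_div_iff_mul_le (Or.inl hCs0) (Or.inl hCst)]
    exact (hu h).trans (pow_le_pow_right_of_le_one' hp1.le (Nat.pow_le_pow_left hD h))
  calc checkBound dL k c g b h ^ (dL - 1) ≤ (p ^ 2 ^ h * (C ^ s)⁻¹) ^ (dL - 1) := by gcongr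
    _ = (p ^ 2 ^ h) ^ (dL - 1) * (C ^ s)⁻¹ ^ (dL - 1) := mul_pow _ _ _
    _ ≤ p ^ 2 ^ h * (C ^ s)⁻¹ ^ (dL - 1) := by
      refine mul_le_mul_left (pow_le_of_le_one zero_le (pow_le_one' hp1.le _) hdL1) _

end TannerCode

/-! ### Exponential moments of extended-real LLRs -/

/-- After sorting, S becomes a k-set of positions, and the m-th element of such a set is at least m.
-/
theorem sumSmallest_le_sum {n k : ℕ} (v : Fin n → EReal) (S : Finset (Fin n)) (hS : S.card = k) :
    sumSmallest k v ≤ ∑ i ∈ S, v i := by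
  classical
  set σ := Tuple.sort v
  have hmono : Monotone (v ∘ σ) := Tuple.monotone_sort v
  set S' := S.map σ.symm.toEmbedding with hS'
  have hcard : S'.card = k := by rw [hS', Finset.card_map, hS]
  have hkn : k ≤ n := hS ▸ (Finset.card_le_univ S).trans_eq (Fintype.card_fin n)
  have e1 : ∑ i ∈ S, v i = ∑ i : Fin k, (v ∘ σ) (S'.orderEmbOfFin hcard i) := by
    have : ∑ i ∈ S, v i = ∑ i ∈ S', (v ∘ σ) i := by simp [hS', Finset.sum_map]
    rw [this]
    conv_lhs => rw [← Finset.map_orderEmbOfFin_univ S' hcard, Finset.sum_map]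
    rfl
  have e2 : sumSmallest k v = ∑ i : Fin k, (v ∘ σ) (Fin.castLE hkn i) := by
    have : (Finset.univ : Finset (Fin n)).filter (fun i : Fin n => i.val < k) =
        Finset.univ.map (Fin.castLEEmb hkn) := by
      ext i
      simp only [Finset.mem_filter, Finset.mem_univ, true_and, Finset.mem_map]
      exact ⟨fun h => ⟨⟨i, h⟩, by ext; simp⟩, by rintro ⟨a, rfl⟩; exact a.2⟩
    rw [sumSmallest, this, Finset.sum_map]
    rfl
  rw [e1, e2]
  refine Finset.sum_le_sum fun i _ => hmono ?_
  have hlt : ∀ m (hm : m < k), m ≤ (S'.orderEmbOfFin hcard ⟨m, hm⟩).val := by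
    intro m
    induction m with
    | zero => exact fun _ => Nat.zero_le _
    | succ m ih =>
      intro hm
      have : S'.orderEmbOfFin hcard ⟨m, by omega⟩ < S'.orderEmbOfFin hcard ⟨m + 1, hm⟩ :=
        (S'.orderEmbOfFin hcard).strictMono (by simp)
      have h2 := ih (by omega)
      have h3 : (S'.orderEmbOfFin hcard ⟨m, by omega⟩).val <
        (S'.orderEmbOfFin hcard ⟨m + 1, hm⟩).val := this
      omega
  exact hlt i i.2

/-- The value ⊥ must be excluded: for t > 0, ⊤ + ⊥ = ⊥ would give ∞ on the left but 0 * ∞ = 0 on the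
right. -/
theorem EReal.exp_neg_mul_sum {ι : Type*} (t : ℝ) (ht : 0 ≤ t) (S : Finset ι) (l : ι → EReal)
    (hl : ∀ i ∈ S, l i ≠ ⊥) :
    EReal.exp (-((t : EReal) * ∑ i ∈ S, l i)) = ∏ i ∈ S, EReal.exp (-((t : EReal) * l i)) := by
  classical
  have hbot : ∀ a : EReal, a ≠ ⊥ → (t : EReal) * a ≠ ⊥ := by
    intro a ha
    induction a with
    | bot => exact absurd rfl ha
    | coe a => rw [← EReal.coe_mul]; exact EReal.coe_ne_bot _
    | top =>
      rcases ht.eq_or_lt with h | h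
      · simp [← h]
      · simp [EReal.coe_mul_top_of_pos h]
  suffices h : ∑ i ∈ S, l i ≠ ⊥ ∧
      EReal.exp (-((t : EReal) * ∑ i ∈ S, l i)) = ∏ i ∈ S, EReal.exp (-((t : EReal) * l i)) from h.2
  induction S using Finset.induction_on with
  | empty => simp
  | insert a S ha ih =>
    obtain ⟨h1, h2⟩ := ih fun i hi => hl i (Finset.mem_insert_of_mem hi)
    have h3 := hl a (Finset.mem_insert_self a S)
    rw [Finset.sum_insert ha, Finset.prod_insert ha, ← h2, ← EReal.exp_add]
    refine ⟨by simp [h1, h3], ?_⟩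
    rw [EReal.left_distrib_of_nonneg_of_ne_top (by exact_mod_cast ht) (EReal.coe_ne_top t),
      EReal.neg_add (Or.inl (hbot _ h3)) (Or.inr (hbot _ h1)), sub_eq_add_neg]

namespace MBIOSChannel

/-- The real value of `e^{-tγ}` (zero where that is infinite). -/
def expLlr (W : MBIOSChannel) (t : ℝ≥0) (y : ℝ) : ℝ≥0 :=
  (EReal.exp (-(((t : ℝ) : EReal) * W.llr y))).toNNReal

theorem measurable_llr (W : MBIOSChannel) : Measurable W.llr :=
  ENNReal.measurable_log.comp ((W.measurable_density 0).coe_nnreal_ennreal.div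
    (W.measurable_density 1).coe_nnreal_ennreal)

theorem measurable_expLlr (W : MBIOSChannel) (t : ℝ≥0) : Measurable (W.expLlr t) := by
  have h : Measurable fun y => ((t : ℝ) : EReal) * W.llr y := measurable_const.mul W.measurable_llr
  exact (EReal.measurable_exp.comp h.neg).ennreal_toNNReal

theorem lintegral_expLlr_le (W : MBIOSChannel) (t : ℝ≥0) :
    ∫⁻ a, (a : ℝ≥0∞) ∂((W.law 0).map (W.expLlr t)) ≤ W.expGamma t := by
  rw [lintegral_map measurable_coe_nnreal_ennreal (W.measurable_expLlr t)]
  exact lintegral_mono fun y => ENNReal.coe_toNNReal_le_self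

/-- A product of values e^{-tγ} is largest over the k smallest LLRs, where it is e^{-tX₀}.
Truncating infinite values to 0 only lowers the left side. -/
theorem lintegral_maxProd_expLlr_le (W : MBIOSChannel) (n k : ℕ) (t : ℝ≥0) (ht : 0 < t) :
    ∫⁻ z, (maxProd k Finset.univ z : ℝ≥0∞)
      ∂(Measure.pi fun _ : Fin n => (W.law 0).map (W.expLlr t)) ≤ W.expXZero n k t := by
  have : IsProbabilityMeasure ((W.law 0).map (W.expLlr t)) :=
    Measure.isProbabilityMeasure_map (W.measurable_expLlr t).aemeasurable
  have hmp : MeasurePreserving (fun (y : Fin n → ℝ) i => W.expLlr t (y i))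
      (Measure.pi fun _ => W.law 0) (Measure.pi fun _ : Fin n => (W.law 0).map (W.expLlr t)) :=
    measurePreserving_pi _ _ fun _ => (W.measurable_expLlr t).measurePreserving _
  rw [← hmp.lintegral_comp (continuous_maxProd k _).measurable.coe_nnreal_ennreal]
  refine lintegral_mono fun y => ?_
  rw [maxProd, ENNReal.coe_finset_sup]
  refine Finset.sup_le fun S hS => ?_
  rw [ENNReal.ofNNReal_finsetProd]
  -- An LLR ⊥ gives e^{-tγ} = ∞ since t > 0, and `toNNReal` sends it to 0, so the product vanishes.
  by_cases hbot : ∃ i ∈ S, W.llr (y i) = ⊥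
  · obtain ⟨i, hi, hib⟩ := hbot
    rw [Finset.prod_eq_zero hi]
    · exact zero_le
    · simp [expLlr, hib, EReal.coe_mul_bot_of_pos (show (0 : ℝ) < t from ht)]
  · push Not at hbot
    calc ∏ i ∈ S, (W.expLlr t (y i) : ℝ≥0∞)
        ≤ ∏ i ∈ S, EReal.exp (-(((t : ℝ) : EReal) * W.llr (y i))) :=
          Finset.prod_le_prod' fun i _ => ENNReal.coe_toNNReal_le_self
      _ = EReal.exp (-(((t : ℝ) : EReal) * ∑ i ∈ S, W.llr (y i))) :=
          (EReal.exp_neg_mul_sum t t.2 S _ hbot).symm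
      _ ≤ _ := by
          refine EReal.exp_monotone (EReal.neg_le_neg_iff.2 ?_)
          exact mul_le_mul_of_nonneg_left
            (sumSmallest_le_sum _ S (Finset.mem_powersetCard.1 hS).2) (by exact_mod_cast t.2)

end MBIOSChannel

/-! ### Reduction to the zero word, with infinite LLRs -/

namespace TannerCode

variable {N J : ℕ}

/-- The reflection of the cube that exchanges the word `c` and the zero word. -/
def reflect (c : Fin N → ZMod 2) (x : Fin N → ℝ) : Fin N → ℝ :=
  fun i => bitsToReal c i + (1 - 2 * bitsToReal c i) * x i

theorem reflect_bitsToReal (c w : Fin N → ZMod 2) :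
    reflect c (bitsToReal w) = bitsToReal (c + w) := by
  have h : ∀ a b : ZMod 2, a.val + b.val = (a + b).val + 2 * (a.val * b.val) := by decide
  funext i
  have := congrArg (Nat.cast (R := ℝ)) (h (c i) (w i))
  push_cast at this
  simp only [reflect, bitsToReal, Pi.add_apply]
  linarith

/-- `reflect c` is affine and acts on binary words as addition of c, which preserves each extended
local code. -/
theorem reflect_mem_polytope (T : TannerCode N J) {c : Fin N → ZMod 2} (hc : c ∈ T.code)
    {x : Fin N → ℝ} (hx : x ∈ T.polytope) : reflect c x ∈ T.polytope := by
  refine Set.mem_iInter.2 fun j => ?_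
  have hsub : convexHull ℝ (bitsToReal '' T.extendedCode j) ⊆
      reflect c ⁻¹' convexHull ℝ (bitsToReal '' T.extendedCode j) := by
    refine convexHull_min ?_ ?_
    · rintro _ ⟨w, hw, rfl⟩
      refine subset_convexHull ℝ _ ⟨c + w, ?_, (reflect_bitsToReal c w).symm⟩
      exact (T.localCode j).add_mem (Set.mem_iInter.1 hc j) hw
    · intro y hy z hz p q hp hq hpq
      have : reflect c (p • y + q • z) = p • reflect c y + q • reflect c z := by
        funext i
        simp only [reflect, Pi.add_apply, Pi.smul_apply, smul_eq_mul]
        linear_combination (-bitsToReal c i) * hpq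
      rw [Set.mem_preimage, this]
      exact convex_convexHull ℝ _ hy hz hp hq hpq
  exact hsub (Set.mem_iInter.1 hx j)

/-- By the symmetry of the polytope it suffices to decode the zero word. -/
theorem isUniqueLPOptimum_of_reflect (T : TannerCode N J) {c : Fin N → ZMod 2} (hc : c ∈ T.code)
    {l l' : Fin N → EReal} (hl : ∀ i, l i = if c i = 0 then l' i else -l' i)
    (h : ∀ x ∈ T.polytope, x ≠ 0 → 0 < ∑ i, l' i * (x i : EReal)) :
    T.IsUniqueLPOptimum l c := by
  refine ⟨Set.mem_iInter.2 fun j => subset_convexHull ℝ _ ⟨c, Set.mem_iInter.1 hc j, rfl⟩, ?_⟩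
  intro x hx hxc
  have hbit : ∀ i, (c i = 0 ∧ bitsToReal c i = 0) ∨ (c i ≠ 0 ∧ bitsToReal c i = 1) := by
    have hb : ∀ b : ZMod 2, b = 0 ∨ b = 1 := by decide
    intro i
    unfold bitsToReal
    rcases hb (c i) with h | h <;> simp [h, ZMod.val_one]
  have hne : reflect c x ≠ 0 := by
    intro h0
    refine hxc (funext fun i => ?_)
    have := congrFun h0 i
    simp only [reflect, Pi.zero_apply] at this
    rcases hbit i with ⟨-, hb⟩ | ⟨-, hb⟩ <;> rw [hb] at this ⊢ <;> linarith
  refine (h _ (T.reflect_mem_polytope hc hx) hne).trans_eq (Finset.sum_congr rfl fun i _ => ?_)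
  rcases hbit i with ⟨hc, hb⟩ | ⟨hc, hb⟩
  · simp [hl, hc, reflect, hb]
  · rw [hl, if_neg hc, neg_mul, ← mul_neg, ← EReal.coe_neg]
    simp only [reflect, hb]
    congr 2
    ring

/-- If all messages are less than one, then the zero word is the unique LP optimum. Here the
log-likelihood ratios may be `⊤`. -/
theorem sum_mul_pos_of_msg_lt_one (T : TannerCode N J) {dL dR d : ℕ} (hd : 2 ≤ d) (hdL : 1 ≤ dL)
    (hL : ∀ i, (T.checks i).card = dL) (hR : ∀ j, (T.nb j).card = dR)
    (hT : (d : ℕ∞) ≤ T.minLocalDist) {t : ℝ} (ht : 0 < t) {l : Fin N → EReal}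
    (hl : ∀ i, l i ≠ ⊥) (h : ℕ)
    (hmsg : ∀ i, ∀ j ∈ T.checks i,
      T.msg (d - 1) (fun i => (EReal.exp (-((t : EReal) * l i))).toNNReal) h i j < 1)
    {x : Fin N → ℝ} (hx : x ∈ T.polytope) (hx0 : x ≠ 0) :
    0 < ∑ i, l i * (x i : EReal) := by
  set z : Fin N → ℝ≥0 := fun i => (EReal.exp (-((t : EReal) * l i))).toNNReal with hz
  -- An LLR ⊤ makes z i = 0, where the logarithm is useless. Raising z to at least a small ε > 0
  -- keeps the finitely many messages below 1 and only lowers the costs, so positivity passes back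
  -- to l.
  have hcont : Continuous fun ε : ℝ≥0 => fun i => max (z i) ε := by fun_prop
  have hev : ∀ᶠ ε in nhdsWithin (0 : ℝ≥0) (Set.Ioi 0),
      ∀ i, ∀ j ∈ T.checks i, T.msg (d - 1) (fun i => max (z i) ε) h i j < 1 := by
    refine nhdsWithin_le_nhds ?_
    refine Filter.eventually_all.2 fun i => (Filter.eventually_all_finset _).2 fun j hj => ?_
    refine ((T.continuous_msg (d - 1) h i j).comp hcont).continuousAt.eventually_lt
      continuousAt_const ?_
    simpa using hmsg i j hj
  obtain ⟨ε, hε, hε0⟩ := (hev.and self_mem_nhdsWithin).exists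
  have hpos := T.sum_neg_log_mul_pos hd hdL hL hR hT (fun i => lt_max_of_lt_right hε0) h hε hx hx0
  have hxnn : ∀ i, 0 ≤ x i := fun i => by
    obtain ⟨j, -⟩ := Finset.card_pos.1 (show 0 < (T.checks i).card by rw [hL]; omega)
    exact T.nonneg_of_mem_convexHull j x (Set.mem_iInter.1 hx j) i
  have hle : ∀ i, ((-Real.log (max (z i) ε : ℝ≥0) / t : ℝ) : EReal) ≤ l i := by
    intro i
    have hi := hl i
    have hzi : z i = (EReal.exp (-((t : EReal) * l i))).toNNReal := rfl
    induction hli : l i with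
    | bot => exact absurd hli hi
    | top => exact le_top
    | coe r =>
      rw [hli, ← EReal.coe_mul, ← EReal.coe_neg, EReal.exp_coe] at hzi
      have hzi' : (z i : ℝ) = Real.exp (-(t * r)) := by
        rw [hzi, ENNReal.coe_toNNReal_eq_toReal, ENNReal.toReal_ofReal (Real.exp_pos _).le]
      have : -(t * r) ≤ Real.log (max (z i) ε : ℝ≥0) := by
        rw [← Real.log_exp (-(t * r)), ← hzi']
        refine Real.log_le_log (by rw [hzi']; exact Real.exp_pos _) ?_
        exact_mod_cast le_max_left (z i) ε
      rw [EReal.coe_le_coe_iff, div_le_iff₀ ht]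
      linarith
  have hcoe : ((∑ i, (-Real.log (max (z i) ε : ℝ≥0) / t) * x i : ℝ) : EReal) =
      ∑ i, ((-Real.log (max (z i) ε : ℝ≥0) / t : ℝ) : EReal) * (x i : EReal) := by
    simp only [← EReal.coe_mul]
    exact map_sum (⟨⟨Real.toEReal, EReal.coe_zero⟩, EReal.coe_add⟩ : ℝ →+ EReal) _ _
  have hsum : 0 < ∑ i, (-Real.log (max (z i) ε : ℝ≥0) / t) * x i := by
    have : ∑ i, (-Real.log (max (z i) ε : ℝ≥0) / t) * x i =
        (∑ i, -Real.log (max (z i) ε : ℝ≥0) * x i) / t := by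
      rw [Finset.sum_div]
      exact Finset.sum_congr rfl fun i _ => by ring
    rw [this]
    exact div_pos hpos ht
  refine (EReal.coe_pos.2 hsum).trans_le (hcoe.trans_le ?_)
  exact Finset.sum_le_sum fun i _ =>
    mul_le_mul_of_nonneg_right (hle i) (by exact_mod_cast hxnn i)

end TannerCode

/-! ### Channel symmetry and the failure probability -/

namespace MBIOSChannel

/-- Negation swaps the densities and inverts their ratio. The hypothesis rules out 0/0, which is 0
in `ℝ≥0∞` and not inverted. -/
theorem llr_neg (W : MBIOSChannel) {y : ℝ} (hy : W.density 0 y ≠ 0) : W.llr (-y) = -W.llr y := by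
  have h1 : W.density 1 (-y) = W.density 0 y := (W.symm y).symm
  have h0 : W.density 0 (-y) = W.density 1 y := by rw [W.symm, neg_neg]
  rw [llr, llr, h1, h0, ← ENNReal.log_inv, ENNReal.inv_div (Or.inr (by simp))
    (Or.inr (by simp [hy]))]

theorem llr_ne_bot (W : MBIOSChannel) {y : ℝ} (hy : W.density 0 y ≠ 0) : W.llr y ≠ ⊥ := by
  rw [llr, Ne, ENNReal.log_eq_bot_iff, ENNReal.div_eq_zero_iff]
  simp [hy]

theorem measurePreserving_neg_law (W : MBIOSChannel) :
    MeasurePreserving (fun y : ℝ => -y) (W.law 1) (W.law 0) := by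
  refine ⟨measurable_neg, Measure.ext fun A hA => ?_⟩
  have hmp : MeasurePreserving (fun y : ℝ => -y) W.ref W.ref := ⟨measurable_neg, W.ref_neg⟩
  rw [Measure.map_apply measurable_neg hA, law, law, withDensity_apply _ (measurable_neg hA),
    withDensity_apply _ hA,
    ← hmp.setLIntegral_comp_preimage hA (W.measurable_density 0).coe_nnreal_ennreal]
  refine setLIntegral_congr_fun (measurable_neg hA) fun y _ => ?_
  simp only [W.symm (-y), neg_neg]

theorem measurePreserving_flip (W : MBIOSChannel) {N : ℕ} (c : Fin N → ZMod 2) :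
    MeasurePreserving (fun (y : Fin N → ℝ) i => if c i = 0 then y i else -y i) (W.wordLaw c)
      (Measure.pi fun _ => W.law 0) := by
  refine measurePreserving_pi _ _ (f := fun i y => if c i = 0 then y else -y) fun i => ?_
  have hb : ∀ b : ZMod 2, b = 0 ∨ b = 1 := by decide
  rcases hb (c i) with h | h
  · simp only [h, if_true]
    exact MeasurePreserving.id _
  · simp only [h, one_ne_zero, if_false]
    exact W.measurePreserving_neg_law

theorem law_density_eq_zero (W : MBIOSChannel) : W.law 0 {y | W.density 0 y = 0} = 0 := by
  have hm : MeasurableSet {y | W.density 0 y = 0} :=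
    W.measurable_density 0 (measurableSet_singleton 0)
  rw [law, withDensity_apply _ hm, setLIntegral_congr_fun (g := fun _ => 0) hm
    (fun y hy => by simpa using hy)]
  simp

/-- A union bound for the probability that LP decoding fails. -/
theorem one_sub_le_wordLaw (W : MBIOSChannel) {N J : ℕ} (T : TannerCode N J) {dL dR d : ℕ}
    (hd : 2 ≤ d) (hdL : 1 ≤ dL) (hL : ∀ i, (T.checks i).card = dL) (hR : ∀ j, (T.nb j).card = dR)
    (hT : (d : ℕ∞) ≤ T.minLocalDist) {t : ℝ≥0} (ht : 0 < t) (h : ℕ) {ε : ℝ≥0}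
    (hε : ∀ i, ∀ j ∈ T.checks i, ∫⁻ z, (T.msg (d - 1) z h i j : ℝ≥0∞)
      ∂(Measure.pi fun _ => (W.law 0).map (W.expLlr t)) ≤ ε)
    {c : Fin N → ZMod 2} (hc : c ∈ T.code) :
    1 - N * dL * (ε : ℝ) ≤
      (W.wordLaw c).real {y | T.IsUniqueLPOptimum (fun i => W.llr (y i)) c} := by
  have : IsProbabilityMeasure ((W.law 0).map (W.expLlr t)) :=
    Measure.isProbabilityMeasure_map (W.measurable_expLlr t).aemeasurable
  have : IsProbabilityMeasure (W.wordLaw c) := by unfold wordLaw; infer_instance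
  set φ : (Fin N → ℝ) → Fin N → ℝ := fun y i => if c i = 0 then y i else -y i with hφ
  have hφm := W.measurePreserving_flip c
  have hψm : MeasurePreserving (fun (y : Fin N → ℝ) i => W.expLlr t (y i))
      (Measure.pi fun _ => W.law 0) (Measure.pi fun _ => (W.law 0).map (W.expLlr t)) :=
    measurePreserving_pi _ _ fun _ => (W.measurable_expLlr t).measurePreserving _
  set A : Set (Fin N → ℝ) := {y | T.IsUniqueLPOptimum (fun i => W.llr (y i)) c}
  -- Failure requires, after flipping, a symbol of zero density under 0 (a null event) or an edge
  -- with message at least 1 (probability at most ε by Markov).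
  set B1 : Fin N → Set (Fin N → ℝ) := fun i => {y | W.density 0 (y i) = 0} with hB1
  set B2 : Fin N → Fin J → Set (Fin N → ℝ) := fun i j =>
    {y | 1 ≤ T.msg (d - 1) (fun i => W.expLlr t (y i)) h i j} with hB2
  have hB1m : ∀ i, MeasurableSet (B1 i) := fun i =>
    ((W.measurable_density 0).comp (measurable_pi_apply i)) (measurableSet_singleton 0)
  have hB2m : ∀ i j, MeasurableSet (B2 i j) := fun i j => measurableSet_le measurable_const
    ((T.continuous_msg (d - 1) h i j).measurable.comp hψm.measurable)
  have hB1z : ∀ i, W.wordLaw c (φ ⁻¹' B1 i) = 0 := by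
    intro i
    rw [hφm.measure_preimage (hB1m i).nullMeasurableSet]
    have := (measurePreserving_eval (fun _ : Fin N => W.law 0) i).measure_preimage
      (s := {y | W.density 0 y = 0})
      (W.measurable_density 0 (measurableSet_singleton 0)).nullMeasurableSet
    rw [W.law_density_eq_zero] at this
    exact this
  have hB2le : ∀ i, ∀ j ∈ T.checks i, W.wordLaw c (φ ⁻¹' B2 i j) ≤ ε := by
    intro i j hj
    rw [hφm.measure_preimage (hB2m i j).nullMeasurableSet]
    have hmeas : Measurable fun y : Fin N → ℝ =>
        (T.msg (d - 1) (fun i => W.expLlr t (y i)) h i j : ℝ≥0∞) :=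
      (T.measurable_msg (d - 1) h i j).comp hψm.measurable
    have hmk := mul_meas_ge_le_lintegral (μ := Measure.pi fun _ : Fin N => W.law 0) hmeas 1
    rw [one_mul, hψm.lintegral_comp (T.measurable_msg (d - 1) h i j)] at hmk
    refine le_trans (measure_mono fun y hy => ?_) (hmk.trans (hε i j hj))
    exact ENNReal.one_le_coe_iff.2 hy
  have hsub : Aᶜ ⊆ (⋃ i, φ ⁻¹' B1 i) ∪ ⋃ i, ⋃ j ∈ T.checks i, φ ⁻¹' B2 i j := by
    intro y hy
    by_contra hcon
    simp only [Set.mem_union, Set.mem_iUnion, not_or, not_exists] at hcon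
    obtain ⟨h1, h2⟩ := hcon
    have h1 : ∀ i, W.density 0 (φ y i) ≠ 0 := h1
    refine hy (T.isUniqueLPOptimum_of_reflect hc (l' := fun i => W.llr (φ y i)) (fun i => ?_) ?_)
    · have := h1 i
      by_cases hci : c i = 0
      · simp [hφ, hci]
      · simp only [hφ, hci, if_false] at this ⊢
        rw [← W.llr_neg this, neg_neg]
    · intro x hx hx0
      exact T.sum_mul_pos_of_msg_lt_one hd hdL hL hR hT (t := t) ht
        (fun i => W.llr_ne_bot (h1 i)) h (fun i j hj => not_le.1 (h2 i j hj)) hx hx0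
  have hfail : W.wordLaw c Aᶜ ≤ ((N * dL * ε : ℝ≥0) : ℝ≥0∞) := by
    refine (measure_mono hsub).trans ((measure_union_le _ _).trans ?_)
    rw [measure_iUnion_null hB1z, zero_add]
    refine (measure_iUnion_fintype_le _ _).trans ?_
    refine (Finset.sum_le_sum fun i _ => (measure_biUnion_finset_le _ _).trans
      ((Finset.sum_le_card_nsmul _ _ _ (hB2le i)).trans_eq (by rw [hL]))).trans_eq ?_
    simp [mul_assoc]
  -- Subadditivity suffices here, so measurability of the success event A is not needed.
  have htot : (1 : ℝ≥0∞) ≤ W.wordLaw c A + W.wordLaw c Aᶜ := by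
    rw [← measure_univ (μ := W.wordLaw c), ← Set.union_compl_self A]
    exact measure_union_le _ _
  have htot' := htot.trans (add_le_add le_rfl hfail)
  have := ENNReal.toReal_mono (by finiteness) htot'
  rw [ENNReal.toReal_add (by finiteness) (by finiteness)] at this
  simp only [ENNReal.toReal_one, ENNReal.coe_toReal, NNReal.coe_mul, NNReal.coe_natCast] at this
  rw [Measure.real]
  linarith

end MBIOSChannel

/-! ### Choice of the height -/

theorem isLittleO_rpow_rpow_atTop_of_lt {a b : ℝ} (h : a < b) :
    Asymptotics.IsLittleO Filter.atTop (fun x : ℝ => x ^ a) fun x : ℝ => x ^ b := by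
  refine Asymptotics.isLittleO_of_tendsto' ?_ ?_
  · filter_upwards [Filter.eventually_gt_atTop 0] with x hx h0
    exact absurd h0 (Real.rpow_pos_of_pos hx b).ne'
  · refine (tendsto_rpow_neg_atTop (sub_pos.2 h)).congr' ?_
    filter_upwards [Filter.eventually_gt_atTop 0] with x hx
    rw [neg_sub, Real.rpow_sub hx]

open Filter in
/-- A doubly exponentially small bound at logarithmic height beats `exp (-N ^ δ)`. -/
theorem exists_eventually_height {κ : ℝ} (hκ : 0 < κ) (K : ℝ≥0) {p : ℝ} (hp0 : 0 ≤ p) (hp1 : p < 1) :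
    ∃ δ : ℝ, 0 < δ ∧ δ < 1 ∧ ∃ N₀ : ℕ, ∀ N : ℕ, N₀ ≤ N → ∃ h : ℕ, 1 ≤ h ∧
      ((4 * h + 4 : ℕ) : ℝ) < κ * Real.log N ∧ N * K * p ^ 2 ^ h ≤ Real.exp (-(N : ℝ) ^ δ) := by
  -- Enlarging p to q > 0 makes log q meaningful. For h = ⌊(κ/8) log N⌋ one has 2^(h+1) ≥ N^a, hence
  -- q^(2^h) ≤ exp(-e N^a).
  set q := max p (1 / 2) with hq
  have hq0 : 0 < q := lt_max_of_lt_right (by norm_num)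
  have hq1 : q < 1 := max_lt hp1 (by norm_num)
  set a := κ / 8 * Real.log 2 with ha
  have ha0 : 0 < a := by have := Real.log_pos one_lt_two; positivity
  set e := -Real.log q / 2 with he
  have he0 : 0 < e := by have := Real.log_neg hq0 hq1; rw [he]; linarith
  have hmin : 0 < min a 1 := lt_min ha0 one_pos
  refine ⟨min a 1 / 2, by positivity, by linarith [min_le_right a 1], ?_⟩
  have hδ : min a 1 / 2 < a := by linarith [min_le_left a 1]
  have hcast := tendsto_natCast_atTop_atTop (R := ℝ)
  -- The exponent e N^a is split into three equal shares, absorbing N^δ, log N and log(K+1).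
  have ev1 := hcast.eventually ((isLittleO_rpow_rpow_atTop_of_lt hδ).def (c := e / 3) (by positivity))
  have ev2 := hcast.eventually ((isLittleO_log_rpow_atTop ha0).def (c := e / 3) (by positivity))
  have ev3 := hcast.eventually ((tendsto_rpow_atTop ha0).eventually_ge_atTop
    (Real.log (K + 1) / (e / 3)))
  have ev4 := hcast.eventually (Real.tendsto_log_atTop.eventually_gt_atTop (8 / κ))
  obtain ⟨N₀, hN₀⟩ := eventually_atTop.1 (ev1.and (ev2.and (ev3.and (ev4.and
    (eventually_ge_atTop 1)))))
  refine ⟨N₀, fun N hN => ?_⟩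
  obtain ⟨h1, h2, h3, h4, h5⟩ := hN₀ N hN
  have hN0 : (0 : ℝ) < N := by exact_mod_cast h5
  have hlog0 : 0 ≤ Real.log N := Real.log_nonneg (by exact_mod_cast h5)
  have hNa : 0 < (N : ℝ) ^ a := Real.rpow_pos_of_pos hN0 a
  rw [Real.norm_of_nonneg (by positivity), Real.norm_of_nonneg hNa.le] at h1
  rw [Real.norm_of_nonneg hlog0, Real.norm_of_nonneg hNa.le] at h2
  rw [div_le_iff₀ (by positivity)] at h3
  rw [div_lt_iff₀ hκ] at h4
  have h4' : 1 < κ / 8 * Real.log N := by linarith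
  have hfl := Nat.floor_le (show 0 ≤ κ / 8 * Real.log N by linarith)
  have hlt := Nat.lt_floor_add_one (κ / 8 * Real.log N)
  refine ⟨⌊κ / 8 * Real.log N⌋₊, Nat.le_floor (by exact_mod_cast h4'.le), ?_, ?_⟩
  · push_cast
    linarith
  · set h := ⌊κ / 8 * Real.log N⌋₊
    have hpow : (N : ℝ) ^ a ≤ 2 * (2 : ℝ) ^ h := by
      calc (N : ℝ) ^ a = (2 : ℝ) ^ (κ / 8 * Real.log N) := by
            rw [Real.rpow_def_of_pos hN0, Real.rpow_def_of_pos two_pos, ha]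
            congr 1
            ring
        _ ≤ (2 : ℝ) ^ ((h : ℝ) + 1) := Real.rpow_le_rpow_of_exponent_le one_le_two hlt.le
        _ = 2 * (2 : ℝ) ^ h := by
            rw [Real.rpow_add two_pos, Real.rpow_natCast, Real.rpow_one, mul_comm]
    have hpq : p ^ 2 ^ h ≤ Real.exp (-(e * (N : ℝ) ^ a)) := by
      calc p ^ 2 ^ h ≤ q ^ 2 ^ h := pow_le_pow_left₀ hp0 (le_max_left _ _) _
        _ = Real.exp (Real.log q * 2 ^ h) := by
            rw [← Real.rpow_natCast, Real.rpow_def_of_pos hq0]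
            push_cast
            rfl
        _ ≤ _ := by
            refine Real.exp_le_exp.2 ?_
            have : Real.log q = -(2 * e) := by rw [he]; ring
            rw [this]
            nlinarith
    have hK : (K : ℝ) ≤ Real.exp (Real.log (K + 1)) := by
      rw [Real.exp_log (by positivity)]
      linarith
    calc N * K * p ^ 2 ^ h
        ≤ Real.exp (Real.log N) * Real.exp (Real.log (K + 1)) * Real.exp (-(e * (N : ℝ) ^ a)) := by
          rw [Real.exp_log hN0]
          gcongr
      _ = Real.exp (Real.log N + Real.log (K + 1) + -(e * (N : ℝ) ^ a)) := by
          rw [Real.exp_add, Real.exp_add]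
      _ ≤ _ := Real.exp_le_exp.2 (by linarith)

end

/-! ### Assembly of the theorem -/

theorem theorem5 (W : MBIOSChannel) (dL dR d : ℕ) (hd : 2 ≤ d)
    (hD : 2 ≤ (dL - 1) * (d - 1))
    (hcond : (⨅ t : ℝ≥0, W.expXZero (dR - 1) (d - 1) t *
        (((dR - 1).choose (d - 1) : ℝ≥0∞) * W.expGamma t ^ (d - 1)) ^
          (1 / (((dL : ℝ) - 1) * ((d : ℝ) - 1) - 1))) < 1)
    (κ : ℝ) (hκ : 0 < κ) :
    ∃ δ : ℝ, 0 < δ ∧ δ < 1 ∧ ∃ N₀ : ℕ, ∀ N : ℕ, N₀ ≤ N →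
      ∀ (J : ℕ) (T : TannerCode N J), T.IsRegular dL dR → (d : ℕ∞) ≤ T.minLocalDist →
        ENNReal.ofReal (κ * Real.log N) ≤ (T.graph.egirth : ℝ≥0∞) →
        ∀ c ∈ T.code,
          1 - Real.exp (-(N : ℝ) ^ δ) ≤
            (W.wordLaw c).real {y | T.IsUniqueLPOptimum (fun i => W.llr (y i)) c} := by
  have hdL : 2 ≤ dL := by
    by_contra hlt
    have : dL - 1 = 0 := by omega
    simp [this] at hD
  have hDcast : ((dL : ℝ) - 1) * ((d : ℝ) - 1) - 1 = ((((dL - 1) * (d - 1) : ℕ) : ℝ) - 1) := by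
    rw [Nat.cast_mul, Nat.cast_sub (by omega), Nat.cast_sub (by omega), Nat.cast_one]
  rw [hDcast] at hcond
  set s : ℝ := 1 / ((((dL - 1) * (d - 1) : ℕ) : ℝ) - 1) with hs
  have hs0 : 0 < s := by
    have : (2 : ℝ) ≤ ((dL - 1) * (d - 1) : ℕ) := by exact_mod_cast hD
    exact one_div_pos.2 (by linarith)
  -- Positive t is essential later. At t = 0 the expression is a positive power of the binomial
  -- coefficient, hence at least 1 unless that coefficient is 0, in which case every t works.
  obtain ⟨t, ht0, ht⟩ : ∃ t : ℝ≥0, 0 < t ∧ W.expXZero (dR - 1) (d - 1) t *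
      (((dR - 1).choose (d - 1) : ℝ≥0∞) * W.expGamma t ^ (d - 1)) ^ s < 1 := by
    rcases Nat.eq_zero_or_pos ((dR - 1).choose (d - 1)) with hch | hch
    · exact ⟨1, one_pos, by simp [hch, ENNReal.zero_rpow_of_pos hs0]⟩
    · obtain ⟨t, ht⟩ := iInf_lt_iff.1 hcond
      refine ⟨t, pos_iff_ne_zero.2 ?_, ht⟩
      rintro rfl
      refine absurd ht (not_lt.2 ?_)
      have h1 : (1 : ℝ≥0∞) ≤ ((dR - 1).choose (d - 1) : ℝ≥0∞) := by exact_mod_cast hch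
      simpa [MBIOSChannel.expXZero, MBIOSChannel.expGamma] using ENNReal.one_le_rpow h1 hs0
  set p : ℝ≥0∞ := W.expXZero (dR - 1) (d - 1) t *
      (((dR - 1).choose (d - 1) : ℝ≥0∞) * W.expGamma t ^ (d - 1)) ^ s with hp
  set ρ : Measure ℝ≥0 := (W.law 0).map (W.expLlr t) with hρ
  have : IsProbabilityMeasure ρ :=
    Measure.isProbabilityMeasure_map (W.measurable_expLlr t).aemeasurable
  obtain ⟨B, hB⟩ := TannerCode.exists_mul_checkBound_le (p := p)
    (b := ∫⁻ z, (maxProd (d - 1) Finset.univ z : ℝ≥0∞) ∂(Measure.pi fun _ : Fin (dR - 1) => ρ))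
    (c := ((dR - 1).choose (d - 1) : ℝ≥0∞)) (g := ∫⁻ a, (a : ℝ≥0∞) ∂ρ) hdL hD
    (mul_le_mul' (W.lintegral_maxProd_expLlr_le _ _ t ht0)
      (ENNReal.rpow_le_rpow (mul_le_mul' le_rfl (pow_le_pow_left' (W.lintegral_expLlr_le t) _))
        hs0.le)) ht
  lift p to ℝ≥0 using (ht.trans ENNReal.one_lt_top).ne with p' hp'
  obtain ⟨δ, hδ0, hδ1, N₀, hN₀⟩ := exists_eventually_height hκ (dL * B) p'.coe_nonneg
    (by exact_mod_cast ht : (p' : ℝ) < 1)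
  refine ⟨δ, hδ0, hδ1, N₀, fun N hN J T hreg hT hgirth c hc => ?_⟩
  obtain ⟨h, hh1, hh2, hh3⟩ := hN₀ N hN
  have hg : ((4 * h + 4 : ℕ) : ℕ∞) < T.graph.egirth := by
    have h1 : ((4 * h + 4 : ℕ) : ℝ≥0∞) < ENNReal.ofReal (κ * Real.log N) := by
      rw [← ENNReal.ofReal_natCast]
      exact (ENNReal.ofReal_lt_ofReal_iff_of_nonneg (by positivity)).2 hh2
    exact_mod_cast h1.trans_le hgirth
  have hL := TannerCode.card_checks hreg
  have hR := TannerCode.card_nb hreg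
  have hmain := W.one_sub_le_wordLaw T hd (by omega) hL hR hT ht0 (h + 1) (ε := B * p' ^ 2 ^ h)
    (fun i j hj => (T.lintegral_msg_succ_le ρ hL hR h hg i j hj).trans
      ((hB h hh1).trans_eq (by push_cast; rfl))) hc
  refine le_trans ?_ hmain
  push_cast at hh3 ⊢
  rw [← mul_assoc, mul_assoc (N : ℝ)]
  linarith
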